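/- Let $p\neq 2$ be a prime and let $G$ be a pro-$p$ $p$-adic Lie group such that $\phi(G):=\{g^p : g\in G\}$ is a subgroup of $G$; this subgroup is then automatically open and normal in $G$. For a closed subgroup $H\subseteq G$ put $\Lambda^\infty(H):=\varprojlim_U \mathbb{Q}_p[H/U]$, where $U$ runs over the open normal subgroups of $H$. Let $R_H$ be the free abelian group on the set of isomorphism classes $[V]$ of irreducible $\overline{\mathbb{Q}}_p$-representations $V$ of $H$ which are trivial on some open subgroup; every finite dimensional $\overline{\mathbb{Q}}_p$-representation of $H$ which is trivial on some open subgroup has a class in $R_H$, the sum of its irreducible constituents with multiplicities. The group $\mathcal{G}_p:=\mathrm{Gal}(\overline{\mathbb{Q}}_p/\mathbb{Q}_p)$ acts on $R_H$ by conjugating representations, and $\mathrm{Hom}_{\mathcal{G}_p}(R_G,\overline{\mathbb{Q}}_p^\times)$ is the group of $\mathcal{G}_p$-equivariant homomorphisms. The Hom-description is the homomorphism $$\mathrm{Det}\colon K_1(\Lambda^\infty(G))\longrightarrow \mathrm{Hom}_{\mathcal{G}_p}(R_G,\overline{\mathbb{Q}}_p^\times),\qquad [a]\longmapsto\big([V]\mapsto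 {\det}_{\overline{\mathbb{Q}}_p}(a\cdot\,;V)\big)$$ (a matrix $a\in GL_n(\Lambda^\infty(G))$ acts on $V^n$). Let $$N_G\colon K_1(\Lambda^\infty(G))\longrightarrow K_1(\Lambda^\infty(\phi(G)))\longrightarrow K_1(\Lambda^\infty(G))$$ be the transfer (norm) for the finite free ring extension $\Lambda^\infty(\phi(G))\subseteq\Lambda^\infty(G)$ followed by the map induced by the inclusion, and let $$\iota^p\colon R_G\longrightarrow R_G,\qquad \iota^p([V])=\big[V\otimes_{\mathbb{Q}_p}\mathbb{Q}_p[G/\phi(G)]\big],$$ with $G$ acting diagonally on the tensor product. Then: 1. $\iota^p$ is the composite of the restriction $R_G\to R_{\phi(G)}$ and the induction $R_{\phi(G)}\to R_G$. 2. Under the Hom-description, $N_G$ is the adjoint of $\iota^p$: for every $x\in K_1(\Lambda^\infty(G))$, $$\mathrm{Det}(N_G(x))=\mathrm{Det}(x)\circ\iota^p .$$ -/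

import Mathlib

/-! ### The algebraic `K`-group `K₁` and its transfer -/

namespace K1Theory

variable {R S : Type*} [Ring R] [Ring S]

/-- The general linear group `GL_n(R)` of a (not necessarily commutative) ring. -/
abbrev GLn (n : ℕ) (R : Type*) [Ring R] : Type _ := (Matrix (Fin n) (Fin n) R)ˣ

/-- The block sum `M ⊕ 1` of an `i × i` matrix with an identity matrix, of total size `j`. -/
def padMatrix {i j : ℕ} (M : Matrix (Fin i) (Fin i) R) : Matrix (Fin j) (Fin j) R :=
  fun a b => if h : (a : ℕ) < i ∧ (b : ℕ) < i then M ⟨a, h.1⟩ ⟨b, h.2⟩ else if a = b then 1 else 0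

theorem padMatrix_eq {i k : ℕ} (M : Matrix (Fin i) (Fin i) R) :
    (padMatrix M : Matrix (Fin (i + k)) (Fin (i + k)) R) =
      (Matrix.fromBlocks M 0 0 1).submatrix finSumFinEquiv.symm finSumFinEquiv.symm := by
  ext a b
  refine Fin.addCases (fun a => ?_) (fun a => ?_) a <;>
  refine Fin.addCases (fun b => ?_) (fun b => ?_) b <;>
  simp [padMatrix, Matrix.one_apply, Fin.ext_iff]
  all_goals (intro h; omega)

theorem padMatrix_one {i j : ℕ} :
    (padMatrix (1 : Matrix (Fin i) (Fin i) R) : Matrix (Fin j) (Fin j) R) = 1 := by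
  ext a b
  simp only [padMatrix, Matrix.one_apply, Fin.ext_iff]
  split_ifs <;> rfl

theorem padMatrix_mul {i j : ℕ} (h : i ≤ j) (M N : Matrix (Fin i) (Fin i) R) :
    (padMatrix (M * N) : Matrix (Fin j) (Fin j) R) = padMatrix M * padMatrix N := by
  obtain ⟨k, rfl⟩ := Nat.exists_eq_add_of_le h
  simp only [padMatrix_eq, Matrix.submatrix_mul_equiv, Matrix.fromBlocks_multiply]
  simp

/-- The stabilization homomorphism `GL_i(R) → GL_j(R)`, `g ↦ g ⊕ 1`, for `i ≤ j`. -/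
def stab (R : Type*) [Ring R] (i j : ℕ) (h : i ≤ j) : GLn i R →* GLn j R :=
  Units.map
    { toFun := padMatrix
      map_one' := padMatrix_one
      map_mul' := padMatrix_mul h }

theorem stab_apply {i j : ℕ} (h : i ≤ j) (g : GLn i R) :
    (stab R i j h g : Matrix (Fin j) (Fin j) R) = padMatrix (g : Matrix (Fin i) (Fin i) R) := rfl

instance stab_directed : DirectedSystem (fun n => GLn n R) (fun i j h => stab R i j h) where
  map_self i x := by
    ext a b
    simp [stab_apply, padMatrix]
  map_map i j k hij hjk x := by
    ext a b
    simp only [stab_apply, padMatrix, Fin.ext_iff]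
    split_ifs <;> first | rfl | omega

/-- The stable general linear group `GL(R)`, the direct limit of the groups `GL_n(R)`. -/
abbrev GLinf (R : Type*) [Ring R] : Type _ :=
  DirectLimit (fun n => GLn n R) (fun i j h => stab R i j h)

end K1Theory

open K1Theory in
/-- The algebraic `K`-group `K₁(R) = GL(R) / [GL(R), GL(R)]`, written multiplicatively. -/
abbrev K1 (R : Type*) [Ring R] : Type _ := Abelianization (GLinf R)

namespace K1

open K1Theory

variable {R S : Type*} [Ring R] [Ring S] {C : Type*} [CommGroup C]

/-- The class in `K₁(R)` of an invertible matrix. -/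
noncomputable def of (R : Type*) [Ring R] (n : ℕ) : GLn n R →* K1 R :=
  Abelianization.of.comp
    { toFun := fun g => (⟦⟨n, g⟩⟧ : GLinf R)
      map_one' := (DirectLimit.one_def (f := fun i j h => stab R i j h) n).symm
      map_mul' := fun g h =>
        (DirectLimit.mul_def (f := fun i j h => stab R i j h) n g h).symm }

theorem of_stab {i j : ℕ} (h : i ≤ j) (g : GLn i R) : of R j (stab R i j h g) = of R i g := by
  have : (⟦⟨j, stab R i j h g⟩⟧ : GLinf R) = ⟦⟨i, g⟩⟧ :=
    (DirectLimit.eq_of_le (f := fun i j h => stab R i j h) ⟨i, g⟩ j h).symm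
  exact congrArg Abelianization.of this

theorem exists_of (x : K1 R) : ∃ (n : ℕ) (g : GLn n R), of R n g = x := by
  obtain ⟨y, rfl⟩ := QuotientGroup.mk_surjective x
  induction y using Quotient.ind with
  | _ y => exact ⟨y.1, y.2, rfl⟩

/-- A compatible family of homomorphisms `GL_n(R) → C` into an abelian group induces a
homomorphism `K₁(R) → C`. -/
noncomputable def lift (φ : ∀ n, GLn n R →* C)
    (hφ : ∀ i j h g, φ j (stab R i j h g) = φ i g) : K1 R →* C :=
  Abelianization.lift
    { toFun := DirectLimit.lift _ (fun n g => φ n g) (fun i j h g => (hφ i j h g).symm)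
      map_one' := DirectLimit.lift_one (f := fun i j h => stab R i j h) φ _
      map_mul' := DirectLimit.lift_mul (f := fun i j h => stab R i j h) φ _ }

theorem lift_of (φ : ∀ n, GLn n R →* C) (hφ : ∀ i j h g, φ j (stab R i j h g) = φ i g)
    (n : ℕ) (g : GLn n R) : lift φ hφ (of R n g) = φ n g := rfl

/-- Functoriality of `K₁`: a ring homomorphism is applied to the entries of matrices. -/
noncomputable def map (f : R →+* S) : K1 R →* K1 S :=
  lift (fun n => (of S n).comp (Units.map
      (f.mapMatrix : Matrix (Fin n) (Fin n) R →+* Matrix (Fin n) (Fin n) S).toMonoidHom)) (by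
    intro i j h g
    rw [MonoidHom.comp_apply, MonoidHom.comp_apply, ← of_stab h]
    congr 1
    ext a b
    change f (padMatrix (g : Matrix (Fin i) (Fin i) R) a b) = padMatrix (f.mapMatrix g.1) a b
    unfold padMatrix
    split_ifs <;> simp)

/-- A family `b` is a basis of the ring `A` as a right module over `B`, along `f : B → A`. -/
def IsRightBasis {A B : Type*} [Ring A] [Ring B] (f : B →+* A) {m : ℕ} (b : Fin m → A) : Prop :=
  ∀ a : A, ∃! c : Fin m → B, a = ∑ i, b i * f (c i)

section transfer

variable {A B : Type*} [Ring A] [Ring B] {f : B →+* A} {m : ℕ} {b : Fin m → A}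

/-- The coordinates of `a` in a right basis. -/
noncomputable def IsRightBasis.coord (hb : IsRightBasis f b) (a : A) : Fin m → B := (hb a).choose

theorem IsRightBasis.sum_coord (hb : IsRightBasis f b) (a : A) :
    ∑ i, b i * f (hb.coord a i) = a := (hb a).choose_spec.1.symm

theorem IsRightBasis.coord_eq (hb : IsRightBasis f b) {a : A} {c : Fin m → B}
    (h : ∑ i, b i * f (c i) = a) : hb.coord a = c :=
  ((hb a).choose_spec.2 c h.symm).symm

/-- Left multiplication of `A` on itself, written in a basis of `A` as a right `B`-module: the
matrix `M` of `x` is given by `x * b j = ∑ i, b i * M i j`. -/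
noncomputable def IsRightBasis.leftMulMatrix (hb : IsRightBasis f b) :
    A →+* Matrix (Fin m) (Fin m) B where
  toFun x := Matrix.of fun i j => hb.coord (x * b j) i
  map_one' := by
    ext i j
    have : hb.coord (1 * b j) = Pi.single j 1 := hb.coord_eq (by
      rw [Finset.sum_eq_single j] <;> simp +contextual)
    simp only [Matrix.of_apply, this, Pi.single_apply, Matrix.one_apply]
  map_mul' x y := by
    ext i j
    have : hb.coord (x * y * b j) =
        fun i => ∑ k, hb.coord (x * b k) i * hb.coord (y * b j) k := hb.coord_eq (by
      simp only [map_sum, map_mul, Finset.mul_sum]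
      rw [Finset.sum_comm]
      simp only [← mul_assoc, ← Finset.sum_mul, hb.sum_coord]
      simp only [mul_assoc, ← Finset.mul_sum, hb.sum_coord])
    simp [this, Matrix.mul_apply]
  map_zero' := by
    ext i j
    have : hb.coord (0 * b j) = 0 := hb.coord_eq (by simp)
    simp only [Matrix.of_apply, this, Pi.zero_apply, Matrix.zero_apply]
  map_add' x y := by
    ext i j
    have : hb.coord ((x + y) * b j) = hb.coord (x * b j) + hb.coord (y * b j) := hb.coord_eq (by
      simp [mul_add, add_mul, Finset.sum_add_distrib, hb.sum_coord])
    simp [this]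

/-- A matrix over `A` regarded as a matrix of `m × m` blocks over `B`. -/
noncomputable def IsRightBasis.blockMatrix (hb : IsRightBasis f b) (n : ℕ) :
    Matrix (Fin n) (Fin n) A →+* Matrix (Fin (n * m)) (Fin (n * m)) B :=
  ((Matrix.reindexRingEquiv B finProdFinEquiv).toRingHom.comp
    (Matrix.compRingEquiv (Fin n) (Fin m) B).toRingHom).comp hb.leftMulMatrix.mapMatrix

theorem IsRightBasis.blockMatrix_apply (hb : IsRightBasis f b) (n : ℕ)
    (M : Matrix (Fin n) (Fin n) A) (r s : Fin (n * m)) :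
    hb.blockMatrix n M r s = hb.leftMulMatrix (M r.divNat s.divNat) r.modNat s.modNat := rfl

/-- The transfer `K₁(A) → K₁(B)` for a ring homomorphism `f : B → A` such that `A` is free with
basis `b` as a right `B`-module: it is induced by `A → M_m(B)` followed by the Morita isomorphism
`K₁(M_m(B)) = K₁(B)`. -/
noncomputable def transferOfBasis (hb : IsRightBasis f b) : K1 A →* K1 B :=
  lift (fun n => (of B (n * m)).comp (Units.map (hb.blockMatrix n).toMonoidHom)) (by
    intro i j h g
    rw [MonoidHom.comp_apply, MonoidHom.comp_apply, ← of_stab (Nat.mul_le_mul_right m h)]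
    congr 1
    ext r s
    have key : ∀ t : Fin (j * m), (t : ℕ) < i * m ↔ (t.divNat : ℕ) < i := fun t => by
      rw [Fin.coe_divNat, Nat.div_lt_iff_lt_mul (Nat.pos_of_ne_zero ?_)]
      rintro rfl
      exact absurd t.2 (by simp)
    have hrs : r = s ↔ r.divNat = s.divNat ∧ r.modNat = s.modNat := by
      rw [← Prod.mk.injEq]
      exact (finProdFinEquiv.symm.injective.eq_iff (a := r) (b := s)).symm
    change hb.blockMatrix j (padMatrix (g : Matrix (Fin i) (Fin i) A)) r s =
      padMatrix (hb.blockMatrix i g.1) r s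
    rw [hb.blockMatrix_apply]
    unfold padMatrix
    by_cases hlt : (r.divNat : ℕ) < i ∧ (s.divNat : ℕ) < i
    · rw [dif_pos hlt, dif_pos (by rwa [key, key])]
      rfl
    · rw [dif_neg hlt, dif_neg (by rwa [key, key])]
      by_cases hd : r.divNat = s.divNat
      · rw [if_pos hd, map_one, Matrix.one_apply]
        simp only [hrs, hd, true_and]
      · rw [if_neg hd, map_zero, if_neg (by simp [hrs, hd])]
        rfl)

/-- The ring `A` is free of finite rank as a right module over `B`, along `f : B → A`. -/
def RightFree (f : B →+* A) : Prop := ∃ (m : ℕ) (b : Fin m → A), IsRightBasis f b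

/-- The transfer (norm) `N_{A/B} : K₁(A) → K₁(B)` for `A` free of finite rank as a right
`B`-module; it does not depend on the basis. -/
noncomputable def transfer (f : B →+* A) (hf : RightFree f) : K1 A →* K1 B :=
  transferOfBasis hf.choose_spec.choose_spec

end transfer

section det

variable {K : Type*} [Field K] {d : ℕ}

/-- The action of an `n × n` matrix over `R` on `(K ^ d) ^ n`, given a representation
`f : R → M_d(K)`. -/
def blockRep (f : R →+* Matrix (Fin d) (Fin d) K) (n : ℕ) :
    Matrix (Fin n) (Fin n) R →+* Matrix (Fin n × Fin d) (Fin n × Fin d) K :=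
  (Matrix.compRingEquiv (Fin n) (Fin d) K).toRingHom.comp f.mapMatrix

theorem blockRep_apply (f : R →+* Matrix (Fin d) (Fin d) K) (n : ℕ)
    (M : Matrix (Fin n) (Fin n) R) (a b : Fin n × Fin d) :
    blockRep f n M a b = f (M a.1 b.1) a.2 b.2 := rfl

/-- For a representation `f : R → M_d(K)` of a ring over a field, the determinant
`K₁(R) → Kˣ`; a matrix in `GL_n(R)` acts on `(K ^ d) ^ n`. -/
noncomputable def detHom (f : R →+* Matrix (Fin d) (Fin d) K) : K1 R →* Kˣ :=
  lift (fun n => Units.map (Matrix.detMonoidHom.comp (blockRep f n).toMonoidHom)) (by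
    intro i j h g
    obtain ⟨k, rfl⟩ := Nat.exists_eq_add_of_le h
    ext
    change (blockRep f (i + k) (padMatrix (g : Matrix (Fin i) (Fin i) R))).det =
      (blockRep f i g.1).det
    rw [padMatrix_eq]
    let e : (Fin i × Fin d) ⊕ (Fin k × Fin d) ≃ Fin (i + k) × Fin d :=
      (Equiv.sumProdDistrib _ _ _).symm.trans (finSumFinEquiv.prodCongr (Equiv.refl _))
    rw [← Matrix.det_submatrix_equiv_self e]
    have : (blockRep f (i + k) ((Matrix.fromBlocks (g : Matrix (Fin i) (Fin i) R) 0 0 1).submatrix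
          finSumFinEquiv.symm finSumFinEquiv.symm)).submatrix e e =
        Matrix.fromBlocks (blockRep f i g.1) 0 0 1 := by
      ext (⟨a, x⟩ | ⟨a, x⟩) (⟨b, y⟩ | ⟨b, y⟩) <;>
        simp [e, blockRep_apply, Equiv.sumProdDistrib]
      simp only [Matrix.one_apply, Prod.mk.injEq]
      by_cases hab : a = b <;> simp [hab, Matrix.one_apply]
    rw [this, Matrix.det_fromBlocks_zero₂₁, Matrix.det_one, mul_one])

theorem detHom_of (f : R →+* Matrix (Fin d) (Fin d) K) (n : ℕ) (g : GLn n R) :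
    (detHom f (of R n g) : K) = (blockRep f n g.1).det := rfl

end det

end K1

/-! ### The ring `Λ^∞(G)` -/

namespace LambdaInf

variable {p : ℕ} [Fact p.Prime] {G H K : Type*} [Group G] [TopologicalSpace G] [Group H]
  [TopologicalSpace H] [Group K] [TopologicalSpace K]

/-- The homomorphism `ℚ_p[H/U] → ℚ_p[G/V]` induced by a group homomorphism `f : H → G` which maps
`U` into `V`. -/
noncomputable def quotMap (p : ℕ) [Fact p.Prime] (f : H →* G) {U : OpenNormalSubgroup H}
    {V : OpenNormalSubgroup G} (h : ∀ x ∈ U, f x ∈ V) :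
    MonoidAlgebra ℚ_[p] (H ⧸ U.toSubgroup) →+* MonoidAlgebra ℚ_[p] (G ⧸ V.toSubgroup) :=
  MonoidAlgebra.mapDomainRingHom ℚ_[p] (QuotientGroup.map _ _ f h)

theorem le_map {U V : OpenNormalSubgroup G} (h : U ≤ V) : ∀ x ∈ U, MonoidHom.id G x ∈ V :=
  fun _ hx => h hx

theorem quotMap_single (f : H →* G) {U : OpenNormalSubgroup H}
    {V : OpenNormalSubgroup G} (h : ∀ x ∈ U, f x ∈ V) (x : H) (r : ℚ_[p]) :
    quotMap p f h (MonoidAlgebra.single (x : H ⧸ U.toSubgroup) r) =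
      MonoidAlgebra.single (f x : G ⧸ V.toSubgroup) r :=
  MonoidAlgebra.mapDomain_single

/-- Two additive maps out of `ℚ_p[G/U]` agree if they agree on multiples of cosets. -/
theorem addHom_ext {U : OpenNormalSubgroup G} {A : Type*} [AddCommGroup A]
    {f g : MonoidAlgebra ℚ_[p] (G ⧸ U.toSubgroup) →+ A}
    (h : ∀ (x : G) (r : ℚ_[p]), f (MonoidAlgebra.single (x : G ⧸ U.toSubgroup) r) =
      g (MonoidAlgebra.single (x : G ⧸ U.toSubgroup) r))
    (a : MonoidAlgebra ℚ_[p] (G ⧸ U.toSubgroup)) : f a = g a := by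
  induction a using MonoidAlgebra.induction_linear with
  | zero => simp
  | add x y hx hy => simp [hx, hy]
  | single m r =>
    obtain ⟨x, rfl⟩ := QuotientGroup.mk_surjective m
    exact h x r

theorem quotMap_comp (f : H →* G) (g : K →* H) (k : K →* G) {T : OpenNormalSubgroup K}
    {U : OpenNormalSubgroup H} {V : OpenNormalSubgroup G}
    (hf : ∀ x ∈ U, f x ∈ V) (hg : ∀ x ∈ T, g x ∈ U)
    (hk : ∀ x ∈ T, k x ∈ V) (hfg : ∀ x, f (g x) = k x)
    (a : MonoidAlgebra ℚ_[p] (K ⧸ T.toSubgroup)) :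
    quotMap p f hf (quotMap p g hg a) = quotMap p k hk a := by
  refine addHom_ext (f := (quotMap p f hf).toAddMonoidHom.comp (quotMap p g hg).toAddMonoidHom)
    (g := (quotMap p k hk).toAddMonoidHom) (fun x r => ?_) a
  simp [quotMap_single, hfg]

theorem quotMap_id {U : OpenNormalSubgroup G}
    (h : ∀ x ∈ U, MonoidHom.id G x ∈ U)
    (a : MonoidAlgebra ℚ_[p] (G ⧸ U.toSubgroup)) : quotMap p (MonoidHom.id G) h a = a := by
  refine addHom_ext (f := (quotMap p (MonoidHom.id G) h).toAddMonoidHom)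
    (g := AddMonoidHom.id _) (fun x r => ?_) a
  simp [quotMap_single]

/-- The inverse limit of the rings `ℚ_p[G/U]`, where `U` runs over the open normal subgroups. -/
def subring (p : ℕ) [Fact p.Prime] (G : Type*) [Group G] [TopologicalSpace G] :
    Subring (∀ U : OpenNormalSubgroup G, MonoidAlgebra ℚ_[p] (G ⧸ U.toSubgroup)) where
  carrier := {a | ∀ (U V : OpenNormalSubgroup G) (h : U ≤ V),
    quotMap p (MonoidHom.id G) (le_map h) (a U) = a V}
  mul_mem' ha hb U V h := by simp only [Pi.mul_apply, map_mul, ha U V h, hb U V h]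
  one_mem' U V h := by simp only [Pi.one_apply, map_one]
  add_mem' ha hb U V h := by simp only [Pi.add_apply, map_add, ha U V h, hb U V h]
  zero_mem' U V h := by simp only [Pi.zero_apply, map_zero]
  neg_mem' ha U V h := by simp only [Pi.neg_apply, map_neg, ha U V h]

end LambdaInf

/-- The completed group ring `Λ^∞(G) = lim ℚ_p[G/U]` of `G` over `ℚ_p`. -/
abbrev LambdaInf (p : ℕ) [Fact p.Prime] (G : Type*) [Group G] [TopologicalSpace G] : Type _ :=
  LambdaInf.subring p G

namespace LambdaInf

variable {p : ℕ} [Fact p.Prime] {G : Type*} [Group G] [TopologicalSpace G]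

/-- The preimage `U ∩ H` in `H` of an open normal subgroup `U` of `G`. -/
def restrict (H : Subgroup G) (U : OpenNormalSubgroup G) : OpenNormalSubgroup H where
  toSubgroup := U.toSubgroup.comap H.subtype
  isOpen' := U.isOpen'.preimage continuous_subtype_val
  isNormal' := inferInstance

theorem restrict_map (H : Subgroup G) (U : OpenNormalSubgroup G) :
    ∀ x ∈ restrict H U, H.subtype x ∈ U := fun _ hx => hx

theorem restrict_mono (H : Subgroup G) {U V : OpenNormalSubgroup G} (h : U ≤ V) :
    restrict H U ≤ restrict H V := fun _ hx => h hx

/-- The canonical homomorphism `Λ^∞(H) → Λ^∞(G)` for a subgroup `H` of `G`, given by the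
homomorphisms `ℚ_p[H/(U ∩ H)] → ℚ_p[G/U]`. -/
noncomputable def can (p : ℕ) [Fact p.Prime] (H : Subgroup G) :
    LambdaInf p H →+* LambdaInf p G where
  toFun a := ⟨fun U => quotMap p H.subtype (restrict_map H U) (a.1 (restrict H U)), by
    intro U V h
    beta_reduce
    rw [← a.2 _ _ (restrict_mono H h),
      quotMap_comp _ _ H.subtype _ _ (fun x hx => h hx) (fun _ => rfl),
      quotMap_comp _ _ H.subtype _ _ (fun x hx => h hx) (fun _ => rfl)]⟩
  map_one' := by ext1; funext U; exact map_one _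
  map_mul' a b := by ext1; funext U; exact map_mul _ _ _
  map_zero' := by ext1; funext U; exact map_zero _
  map_add' a b := by ext1; funext U; exact map_add _ _ _

theorem can_apply (H : Subgroup G) (a : LambdaInf p H) (U : OpenNormalSubgroup G) :
    (can p H a).1 U = quotMap p H.subtype (restrict_map H U) (a.1 (restrict H U)) := rfl

/-- The image in `Λ^∞(G)` of a group element. -/
noncomputable def ofGroup (p : ℕ) [Fact p.Prime] (g : G) : LambdaInf p G :=
  ⟨fun U => MonoidAlgebra.single (g : G ⧸ U.toSubgroup) 1, fun _ _ _ =>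
    quotMap_single _ _ _ _⟩

/-! ### `Λ^∞(G)` is free of finite rank as a right `Λ^∞(H)`-module, for `H` open in `G` -/

section free

variable {H : Subgroup G}

theorem coset_injective (r : G) (U : OpenNormalSubgroup G) :
    Function.Injective (fun k : H ⧸ (restrict H U).toSubgroup =>
      (r : G ⧸ U.toSubgroup) *
        QuotientGroup.map (restrict H U).toSubgroup U.toSubgroup H.subtype le_rfl k) := by
  intro k l hkl
  obtain ⟨k, rfl⟩ := QuotientGroup.mk_surjective k
  obtain ⟨l, rfl⟩ := QuotientGroup.mk_surjective l
  have h : ((k : G) : G ⧸ U.toSubgroup) = ((l : G) : G ⧸ U.toSubgroup) := mul_left_cancel hkl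
  rw [QuotientGroup.eq] at h
  rw [QuotientGroup.eq]
  exact h

/-- The part of an element of `ℚ_p[G/U]` supported on the coset `r H`, moved to `H`. -/
noncomputable def cosetPart (H : Subgroup G) (r : G) (U : OpenNormalSubgroup G) :
    MonoidAlgebra ℚ_[p] (G ⧸ U.toSubgroup) →+
      MonoidAlgebra ℚ_[p] (H ⧸ (restrict H U).toSubgroup) where
  toFun a := MonoidAlgebra.ofCoeff (a.coeff.comapDomain _ (coset_injective r U).injOn)
  map_zero' := by ext; simp
  map_add' a b := by ext; simp

theorem cosetPart_coeff (r : G) (U : OpenNormalSubgroup G)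
    (a : MonoidAlgebra ℚ_[p] (G ⧸ U.toSubgroup)) (h : H) :
    (cosetPart H r U a).coeff (h : H ⧸ (restrict H U).toSubgroup) =
      a.coeff ((r * h : G) : G ⧸ U.toSubgroup) := rfl

theorem cosetPart_single_mem (r : G) (U : OpenNormalSubgroup G) (g : G) (c : ℚ_[p])
    (h : r⁻¹ * g ∈ H) :
    cosetPart H r U (MonoidAlgebra.single (g : G ⧸ U.toSubgroup) c) =
      MonoidAlgebra.single ((⟨r⁻¹ * g, h⟩ : H) : H ⧸ (restrict H U).toSubgroup) c := by
  classical
  ext k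
  obtain ⟨k, rfl⟩ := QuotientGroup.mk_surjective k
  rw [cosetPart_coeff]
  simp only [MonoidAlgebra.coeff_single, Finsupp.single_apply]
  refine if_congr ?_ rfl rfl
  rw [QuotientGroup.eq, QuotientGroup.eq]
  change _ ↔ ((⟨r⁻¹ * g, h⟩ : H)⁻¹ * k : H).1 ∈ U.toSubgroup
  simp [mul_assoc]

theorem cosetPart_single_notMem (r : G) (U : OpenNormalSubgroup G) (hU : U.toSubgroup ≤ H) (g : G)
    (c : ℚ_[p]) (h : r⁻¹ * g ∉ H) :
    cosetPart H r U (MonoidAlgebra.single (g : G ⧸ U.toSubgroup) c) = 0 := by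
  classical
  ext k
  obtain ⟨k, rfl⟩ := QuotientGroup.mk_surjective k
  rw [cosetPart_coeff]
  simp only [MonoidAlgebra.coeff_single, Finsupp.single_apply]
  rw [if_neg]
  · rfl
  intro hg
  rw [QuotientGroup.eq] at hg
  apply h
  have h1 : (g⁻¹ * (r * k)) ∈ H := hU hg
  have h2 := H.mul_mem k.2 (H.inv_mem h1)
  simpa [mul_assoc] using h2

theorem cosetPart_quotMap (r : G) {U V : OpenNormalSubgroup G} (hUV : U ≤ V)
    (hV : V.toSubgroup ≤ H) (a : MonoidAlgebra ℚ_[p] (G ⧸ U.toSubgroup)) :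
    quotMap p (MonoidHom.id H) (le_map (restrict_mono H hUV)) (cosetPart H r U a) =
      cosetPart H r V (quotMap p (MonoidHom.id G) (le_map hUV) a) := by
  refine addHom_ext (f := (quotMap p (MonoidHom.id H)
      (le_map (restrict_mono H hUV))).toAddMonoidHom.comp (cosetPart H r U))
    (g := (cosetPart H r V).comp (quotMap p (MonoidHom.id G) (le_map hUV)).toAddMonoidHom)
    (fun x c => ?_) a
  simp only [AddMonoidHom.comp_apply, RingHom.toAddMonoidHom_eq_coe, AddMonoidHom.coe_coe,
    quotMap_single, MonoidHom.id_apply]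
  by_cases h : r⁻¹ * x ∈ H
  · rw [cosetPart_single_mem _ _ _ _ h, cosetPart_single_mem _ _ _ _ h, quotMap_single]
    rfl
  · rw [cosetPart_single_notMem _ _ (le_trans hUV hV) _ _ h,
      cosetPart_single_notMem _ _ hV _ _ h, map_zero]

variable {m : ℕ} {r : Fin m → G}

theorem sum_cosetPart (hr : ∀ g, ∃! i, (r i)⁻¹ * g ∈ H) {U : OpenNormalSubgroup G}
    (hU : U.toSubgroup ≤ H) (a : MonoidAlgebra ℚ_[p] (G ⧸ U.toSubgroup)) :
    ∑ i, MonoidAlgebra.single (r i : G ⧸ U.toSubgroup) 1 *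
      quotMap p H.subtype (restrict_map H U) (cosetPart H (r i) U a) = a := by
  have := addHom_ext (f := ∑ i, (AddMonoidHom.mulLeft
      (MonoidAlgebra.single (r i : G ⧸ U.toSubgroup) (1 : ℚ_[p]))).comp
      ((quotMap p H.subtype (restrict_map H U)).toAddMonoidHom.comp (cosetPart H (r i) U)))
    (g := AddMonoidHom.id _) (fun x c => ?_) a
  · simpa [AddMonoidHom.finsetSum_apply] using this
  obtain ⟨i, hi, huniq⟩ := hr x
  rw [AddMonoidHom.finsetSum_apply, Finset.sum_eq_single i]
  · simp only [AddMonoidHom.comp_apply, RingHom.toAddMonoidHom_eq_coe, AddMonoidHom.coe_coe,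
      cosetPart_single_mem _ _ _ _ hi,
      quotMap_single, AddMonoidHom.coe_mulLeft, MonoidAlgebra.single_mul_single,
      AddMonoidHom.id_apply, one_mul, ← QuotientGroup.mk_mul]
    simp
  · intro j _ hj
    simp only [AddMonoidHom.comp_apply, RingHom.toAddMonoidHom_eq_coe, AddMonoidHom.coe_coe]
    rw [cosetPart_single_notMem _ _ hU _ _ (fun h => hj (huniq j h)), map_zero, map_zero]
  · simp

theorem cosetPart_sum (hr : ∀ g, ∃! i, (r i)⁻¹ * g ∈ H) {U : OpenNormalSubgroup G}
    (hU : U.toSubgroup ≤ H) (c : Fin m → MonoidAlgebra ℚ_[p] (H ⧸ (restrict H U).toSubgroup))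
    (k : Fin m) :
    cosetPart H (r k) U (∑ i, MonoidAlgebra.single (r i : G ⧸ U.toSubgroup) 1 *
      quotMap p H.subtype (restrict_map H U) (c i)) = c k := by
  have key : ∀ i x, cosetPart H (r k) U (MonoidAlgebra.single (r i : G ⧸ U.toSubgroup) 1 *
      quotMap p H.subtype (restrict_map H U) x) = if i = k then x else 0 := by
    intro i x
    have := addHom_ext (f := (cosetPart H (r k) U).comp ((AddMonoidHom.mulLeft
        (MonoidAlgebra.single (r i : G ⧸ U.toSubgroup) (1 : ℚ_[p]))).comp
        (quotMap p H.subtype (restrict_map H U)).toAddMonoidHom))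
      (g := if i = k then AddMonoidHom.id _ else 0) (fun y t => ?_) x
    · simp only [AddMonoidHom.comp_apply, RingHom.toAddMonoidHom_eq_coe, AddMonoidHom.coe_coe,
        AddMonoidHom.coe_mulLeft] at this
      rw [this]
      split_ifs <;> rfl
    simp only [AddMonoidHom.comp_apply, RingHom.toAddMonoidHom_eq_coe, AddMonoidHom.coe_coe,
      AddMonoidHom.coe_mulLeft,
      quotMap_single, MonoidAlgebra.single_mul_single, one_mul, ← QuotientGroup.mk_mul]
    split_ifs with h
    · subst h
      have hy : (r i)⁻¹ * (r i * H.subtype y) ∈ H := by simp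
      rw [cosetPart_single_mem _ _ _ _ hy]
      simp
    · rw [cosetPart_single_notMem _ _ hU]
      · rfl
      · intro hk
        refine h ((hr (r i * H.subtype y)).unique ?_ hk)
        simp
  rw [map_sum]
  simp [key]

variable [IsTopologicalGroup G] [CompactSpace G]

/-- The largest open normal subgroup of `G` contained in an open normal subgroup `W` of `H`. -/
def core (hH : IsOpen (H : Set G)) (W : OpenNormalSubgroup H) : OpenNormalSubgroup G where
  toSubgroup := (W.toSubgroup.map H.subtype).normalCore
  isOpen' := by
    have ho : IsOpen ((W.toSubgroup.map H.subtype : Subgroup G) : Set G) := by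
      rw [Subgroup.coe_map]
      exact hH.isOpenMap_subtype_val _ W.isOpen'
    have : Finite (G ⧸ W.toSubgroup.map H.subtype) := Subgroup.quotient_finite_of_isOpen _ ho
    have : (W.toSubgroup.map H.subtype).FiniteIndex :=
      Subgroup.finiteIndex_of_finite_quotient 
    exact Subgroup.isOpen_of_isClosed_of_finiteIndex _
      (Subgroup.normalCore_isClosed _ (Subgroup.isClosed_of_isOpen _ ho))
  isNormal' := Subgroup.normalCore_normal _

theorem core_le (hH : IsOpen (H : Set G)) (W : OpenNormalSubgroup H) :
    restrict H (core hH W) ≤ W := by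
  intro x hx
  obtain ⟨y, hy, hyx⟩ := Subgroup.normalCore_le _ (show x.1 ∈ _ from hx)
  rwa [← Subtype.ext hyx]

theorem core_le_subgroup (hH : IsOpen (H : Set G)) (W : OpenNormalSubgroup H) :
    (core hH W).toSubgroup ≤ H := by
  intro x hx
  obtain ⟨y, hy, hyx⟩ := Subgroup.normalCore_le _ (show x ∈ _ from hx)
  rw [← hyx]
  exact y.2

theorem core_mono (hH : IsOpen (H : Set G)) {W W' : OpenNormalSubgroup H} (h : W ≤ W') :
    core hH W ≤ core hH W' :=
  Subgroup.normalCore_mono (Subgroup.map_mono h)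

theorem core_restrict_le (hH : IsOpen (H : Set G)) (U : OpenNormalSubgroup G) :
    core hH (restrict H U) ≤ U := by
  intro x hx
  obtain ⟨y, hy, hyx⟩ := Subgroup.normalCore_le _ (show x ∈ _ from hx)
  rw [← hyx]
  exact hy

/-- The coordinates of an element of `Λ^∞(G)` with respect to a coset representative. -/
noncomputable def coordinate (hH : IsOpen (H : Set G)) (r : G) (a : LambdaInf p G) :
    LambdaInf p H :=
  ⟨fun W => quotMap p (MonoidHom.id H) (le_map (core_le hH W))
      (cosetPart H r (core hH W) (a.1 (core hH W))), by
    intro W W' h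
    have h1 := cosetPart_quotMap (p := p) r (core_mono hH h) (core_le_subgroup hH W')
      (a.1 (core hH W))
    rw [a.2 _ _ (core_mono hH h)] at h1
    beta_reduce
    have h2 : restrict H (core hH W) ≤ W' := le_trans (core_le hH W) h
    rw [← h1, quotMap_comp _ _ (MonoidHom.id H) _ _ (le_map h2) (fun _ => rfl),
      quotMap_comp _ _ (MonoidHom.id H) _ _ (le_map h2) (fun _ => rfl)]⟩

theorem coordinate_restrict (hH : IsOpen (H : Set G)) (r : G) (a : LambdaInf p G)
    {U : OpenNormalSubgroup G} (hU : U.toSubgroup ≤ H) :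
    (coordinate hH r a).1 (restrict H U) = cosetPart H r U (a.1 U) := by
  have h1 := cosetPart_quotMap (p := p) r (core_restrict_le hH U) hU
    (a.1 (core hH (restrict H U)))
  rw [a.2 _ _ (core_restrict_le hH U)] at h1
  exact h1

theorem isRightBasis_ofGroup (hH : IsOpen (H : Set G)) (hr : ∀ g, ∃! i, (r i)⁻¹ * g ∈ H) :
    K1.IsRightBasis (can p H) (fun i => ofGroup p (r i)) := by
  have hval : ∀ (c : Fin m → LambdaInf p H) (U : OpenNormalSubgroup G),
      (∑ i, ofGroup p (r i) * can p H (c i)).1 U =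
      ∑ i, MonoidAlgebra.single (r i : G ⧸ U.toSubgroup) 1 *
        quotMap p H.subtype (restrict_map H U) ((c i).1 (restrict H U)) := by
    intro c U
    rw [AddSubmonoidClass.coe_finsetSum, Finset.sum_apply]
    rfl
  intro a
  refine ⟨fun i => coordinate hH (r i) a, ?_, ?_⟩
  · have small : ∀ U : OpenNormalSubgroup G, U.toSubgroup ≤ H →
        a.1 U = (∑ i, ofGroup p (r i) * can p H (coordinate hH (r i) a)).1 U := by
      intro U hU
      rw [hval]
      simp only [coordinate_restrict hH _ a hU]
      exact (sum_cosetPart hr hU _).symm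
    ext1
    funext U
    let T : OpenNormalSubgroup H := restrict H ⟨⊤, Subgroup.normal_top⟩
    let U' : OpenNormalSubgroup G := U ⊓ core hH T
    have h1 : U' ≤ U := inf_le_left
    have h2 : U' ≤ core hH T := inf_le_right
    rw [← a.2 U' U h1, ← (∑ i, ofGroup p (r i) * can p H (coordinate hH (r i) a)).2 U' U h1,
      small U' (le_trans h2 (core_le_subgroup hH T))]
  · intro c hc
    funext k
    ext1
    funext W
    have h1 : a.1 (core hH W) = _ := (congrArg (fun x : LambdaInf p G => x.1 (core hH W)) hc).trans
      (hval c (core hH W))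
    change _ = quotMap p (MonoidHom.id H) (le_map (core_le hH W))
      (cosetPart H (r k) (core hH W) (a.1 (core hH W)))
    rw [h1, cosetPart_sum hr (core_le_subgroup hH W) (fun i => (c i).1 (restrict H (core hH W))) k]
    exact ((c k).2 _ _ (core_le hH W)).symm

/-- For an open subgroup `H` of a compact group `G`, the ring `Λ^∞(G)` is free of finite rank as a
right `Λ^∞(H)`-module. -/
theorem rightFree_can (p : ℕ) [Fact p.Prime] (hH : IsOpen (H : Set G)) :
    K1.RightFree (can p H) := by
  have : Finite (G ⧸ H) := Subgroup.quotient_finite_of_isOpen _ hH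
  let e := Finite.equivFin (G ⧸ H)
  refine ⟨Nat.card (G ⧸ H), fun i => ofGroup p (e.symm i).out, isRightBasis_ofGroup hH ?_⟩
  intro g
  refine ⟨e g, ?_, ?_⟩
  · change (e.symm (e g)).out⁻¹ * g ∈ H
    rw [Equiv.symm_apply_apply, ← QuotientGroup.eq]
    exact Quotient.out_eq _
  · intro i hi
    rw [← QuotientGroup.eq] at hi
    rw [← hi]
    simp

end free

end LambdaInf

section Representations

open scoped TensorProduct

/-! ### Representations over an algebraic closure of `ℚ_p` -/

/-- A representation is smooth if it is trivial on some open subgroup. -/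
def IsSmoothRep {k G V : Type*} [Semiring k] [Group G] [TopologicalSpace G] [AddCommMonoid V]
    [Module k V] (ρ : Representation k G V) : Prop :=
  ∃ U : OpenSubgroup G, ∀ g ∈ U, ρ g = 1

namespace LambdaInf

variable {p : ℕ} [Fact p.Prime] {G : Type*} [Group G] [TopologicalSpace G]
  {V : Type*} [AddCommGroup V] [Module (PadicAlgCl p) V]

/-- The action of `ℚ_p[G/U]` on a representation on which `U` acts trivially. -/
noncomputable def actQuot (ρ : Representation (PadicAlgCl p) G V) (U : OpenNormalSubgroup G)
    (hU : ∀ g ∈ U, ρ g = 1) :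
    MonoidAlgebra ℚ_[p] (G ⧸ U.toSubgroup) →+* Module.End (PadicAlgCl p) V :=
  MonoidAlgebra.liftNCRingHom
    ((algebraMap (PadicAlgCl p) (Module.End (PadicAlgCl p) V)).comp
      (algebraMap ℚ_[p] (PadicAlgCl p)))
    (QuotientGroup.lift U.toSubgroup ρ hU)
    (fun x _ => Algebra.commutes (R := PadicAlgCl p) (algebraMap ℚ_[p] (PadicAlgCl p) x) _)

theorem actQuot_single (ρ : Representation (PadicAlgCl p) G V) (U : OpenNormalSubgroup G)
    (hU : ∀ g ∈ U, ρ g = 1) (g : G) (r : ℚ_[p]) (v : V) :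
    actQuot ρ U hU (MonoidAlgebra.single (g : G ⧸ U.toSubgroup) r) v =
      algebraMap ℚ_[p] (PadicAlgCl p) r • ρ g v := by
  exact congrArg (fun T : Module.End (PadicAlgCl p) V => T v)
    (MonoidAlgebra.liftNCRingHom_single _ _ _ _ _)

variable [IsTopologicalGroup G]

/-- The kernel of a smooth representation, as an open normal subgroup. -/
noncomputable def repKernel (ρ : Representation (PadicAlgCl p) G V) (hρ : IsSmoothRep ρ) :
    OpenNormalSubgroup G where
  toSubgroup := MonoidHom.ker ρ
  isOpen' := by
    obtain ⟨U, hU⟩ := hρ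
    exact Subgroup.isOpen_mono (H₁ := U.toSubgroup) (fun g hg => hU g hg) U.isOpen'
  isNormal' := MonoidHom.normal_ker ρ

theorem rep_eq_one (ρ : Representation (PadicAlgCl p) G V) (hρ : IsSmoothRep ρ) :
    ∀ g ∈ repKernel ρ hρ, ρ g = 1 := fun _ hg => hg

/-- The action of `Λ^∞(G)` on a smooth representation `V`: it is the action of `ℚ_p[G/U]`, for `U`
the kernel of the representation. -/
noncomputable def act (ρ : Representation (PadicAlgCl p) G V) (hρ : IsSmoothRep ρ) :
    LambdaInf p G →+* Module.End (PadicAlgCl p) V :=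
  (actQuot ρ (repKernel ρ hρ) (rep_eq_one ρ hρ)).comp
    ((Pi.evalRingHom _ (repKernel ρ hρ)).comp (subring p G).subtype)

theorem act_apply (ρ : Representation (PadicAlgCl p) G V) (hρ : IsSmoothRep ρ)
    (U : OpenNormalSubgroup G) (hU : ∀ g ∈ U, ρ g = 1) (a : LambdaInf p G) :
    act ρ hρ a = actQuot ρ U hU (a.1 U) := by
  have h : U ≤ repKernel ρ hρ := hU
  change actQuot ρ (repKernel ρ hρ) (rep_eq_one ρ hρ) (a.1 (repKernel ρ hρ)) = _
  rw [← a.2 _ _ h]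
  refine addHom_ext (f := (actQuot ρ (repKernel ρ hρ) (rep_eq_one ρ hρ)).toAddMonoidHom.comp
    (quotMap p (MonoidHom.id G) (le_map h)).toAddMonoidHom)
    (g := (actQuot ρ U hU).toAddMonoidHom) (fun x r => ?_) (a.1 U)
  simp only [RingHom.toAddMonoidHom_eq_coe, AddMonoidHom.comp_apply, AddMonoidHom.coe_coe,
    quotMap_single]
  ext1 v
  rw [actQuot_single, actQuot_single]
  rfl

/-- The determinant `K₁(Λ^∞(G)) → Q̄_pˣ`, `[a] ↦ det(a · ; V)`, for a smooth representation on
`V = Q̄_p ^ d`. -/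
noncomputable def det {d : ℕ} (ρ : Representation (PadicAlgCl p) G (Fin d → PadicAlgCl p))
    (hρ : IsSmoothRep ρ) : K1 (LambdaInf p G) →* (PadicAlgCl p)ˣ :=
  K1.detHom (
    (LinearMap.toMatrixAlgEquiv' (R := PadicAlgCl p) (n := Fin d)).toRingEquiv.toRingHom.comp
    (act ρ hρ))

end LambdaInf

/-- The absolute Galois group of `ℚ_p`. -/
abbrev GalQp (p : ℕ) [Fact p.Prime] : Type := PadicAlgCl p ≃ₐ[ℚ_[p]] PadicAlgCl p

/-- A `σ`-semilinear isomorphism between two representations. -/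
structure TwistEquiv {p : ℕ} [Fact p.Prime] {G V W : Type*} [Group G] [AddCommGroup V]
    [Module (PadicAlgCl p) V] [AddCommGroup W] [Module (PadicAlgCl p) W] (σ : GalQp p)
    (ρ : Representation (PadicAlgCl p) G V) (τ : Representation (PadicAlgCl p) G W)
    extends V ≃+ W where
  map_smul' : ∀ (c : PadicAlgCl p) (v : V), toFun (c • v) = σ c • toFun v
  map_rep' : ∀ (g : G) (v : V), toFun (ρ g v) = τ g (toFun v)

namespace TwistEquiv

variable {p : ℕ} [Fact p.Prime] {G V W X Y : Type*} [Group G]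
  [AddCommGroup V] [Module (PadicAlgCl p) V] [AddCommGroup W] [Module (PadicAlgCl p) W]
  [AddCommGroup X] [Module (PadicAlgCl p) X] [AddCommGroup Y] [Module (PadicAlgCl p) Y]
  {σ σ' : GalQp p}
  {ρ : Representation (PadicAlgCl p) G V} {τ : Representation (PadicAlgCl p) G W}
  {υ : Representation (PadicAlgCl p) G X} {ξ : Representation (PadicAlgCl p) G Y}

theorem smul (e : TwistEquiv σ ρ τ) (c : PadicAlgCl p) (v : V) :
    e.toAddEquiv (c • v) = σ c • e.toAddEquiv v := e.map_smul' c v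

theorem rep (e : TwistEquiv σ ρ τ) (g : G) (v : V) :
    e.toAddEquiv (ρ g v) = τ g (e.toAddEquiv v) := e.map_rep' g v

/-- The inverse of a semilinear isomorphism. -/
noncomputable def symm (e : TwistEquiv σ ρ τ) : TwistEquiv σ⁻¹ τ ρ where
  toAddEquiv := e.toAddEquiv.symm
  map_smul' c w := by
    change e.toAddEquiv.symm (c • w) = σ⁻¹ c • e.toAddEquiv.symm w
    rw [AddEquiv.symm_apply_eq, e.smul, AddEquiv.apply_symm_apply]
    exact congrArg (· • w) (σ.apply_symm_apply c).symm
  map_rep' g w := by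
    change e.toAddEquiv.symm (τ g w) = ρ g (e.toAddEquiv.symm w)
    rw [AddEquiv.symm_apply_eq, e.rep, AddEquiv.apply_symm_apply]

/-- The composition of semilinear isomorphisms. -/
noncomputable def trans (e : TwistEquiv σ ρ τ) (e' : TwistEquiv σ' τ υ) :
    TwistEquiv (σ' * σ) ρ υ where
  toAddEquiv := e.toAddEquiv.trans e'.toAddEquiv
  map_smul' c v := by
    change e'.toAddEquiv (e.toAddEquiv (c • v)) = σ' (σ c) • e'.toAddEquiv (e.toAddEquiv v)
    rw [e.smul, e'.smul]
  map_rep' g v := by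
    change e'.toAddEquiv (e.toAddEquiv (ρ g v)) = υ g (e'.toAddEquiv (e.toAddEquiv v))
    rw [e.rep, e'.rep]

/-- An isomorphism of representations is a semilinear isomorphism for the identity. -/
noncomputable def ofEquiv (e : ρ.Equiv τ) : TwistEquiv (1 : GalQp p) ρ τ where
  toAddEquiv := e.toLinearEquiv.toAddEquiv
  map_smul' c v := e.toLinearEquiv.map_smul c v
  map_rep' g v := Representation.IntertwiningMap.isIntertwining ρ τ e.toIntertwiningMap g v

/-- A semilinear isomorphism for the identity is an isomorphism of representations. -/
noncomputable def toRepEquiv (e : TwistEquiv (1 : GalQp p) ρ τ) : ρ.Equiv τ :=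
  .mk { e.toAddEquiv with map_smul' := e.smul } (fun g => by ext v; exact e.rep g v)

/-- The image of a subrepresentation. -/
noncomputable def mapSub (e : TwistEquiv σ ρ τ) (N : Subrepresentation ρ) :
    Subrepresentation τ where
  toSubmodule :=
    { carrier := {w | e.symm.toAddEquiv w ∈ N.toSubmodule}
      add_mem' := fun {a b} ha hb => by
        simp only [Set.mem_ofPred_eq, map_add] at *
        exact N.toSubmodule.add_mem ha hb
      zero_mem' := by simp
      smul_mem' := fun c w hw => by
        simp only [Set.mem_ofPred_eq, e.symm.smul] at *
        exact N.toSubmodule.smul_mem _ hw }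
  apply_mem_toSubmodule g w hw := by
    change e.symm.toAddEquiv (τ g w) ∈ N.toSubmodule
    rw [e.symm.rep]
    exact N.apply_mem_toSubmodule g hw

theorem mem_mapSub (e : TwistEquiv σ ρ τ) (N : Subrepresentation ρ) (w : W) :
    w ∈ e.mapSub N ↔ e.toAddEquiv.symm w ∈ N := Iff.rfl

/-- A semilinear isomorphism induces an isomorphism of the lattices of subrepresentations. -/
noncomputable def subOrderIso (e : TwistEquiv σ ρ τ) :
    Subrepresentation ρ ≃o Subrepresentation τ where
  toFun := e.mapSub
  invFun := e.symm.mapSub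
  left_inv N := by
    apply SetLike.ext
    intro v
    rw [mem_mapSub, mem_mapSub]
    change e.toAddEquiv.symm (e.toAddEquiv v) ∈ N ↔ _
    rw [AddEquiv.symm_apply_apply]
  right_inv N := by
    apply SetLike.ext
    intro v
    rw [mem_mapSub, mem_mapSub]
    change e.toAddEquiv (e.toAddEquiv.symm v) ∈ N ↔ _
    rw [AddEquiv.apply_symm_apply]
  map_rel_iff' := by
    intro M N
    constructor
    · intro h v hv
      have : e.toAddEquiv v ∈ e.mapSub N := h (show e.toAddEquiv v ∈ e.mapSub M by
        rw [mem_mapSub, AddEquiv.symm_apply_apply]; exact hv)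
      rw [mem_mapSub, AddEquiv.symm_apply_apply] at this
      exact this
    · intro h w hw
      exact h hw

theorem isIrreducible (e : TwistEquiv σ ρ τ) (h : ρ.IsIrreducible) :
    τ.IsIrreducible :=
  e.subOrderIso.symm.isSimpleOrder

theorem isSmoothRep [TopologicalSpace G] (e : TwistEquiv σ ρ τ) (h : IsSmoothRep ρ) :
    IsSmoothRep τ := by
  obtain ⟨U, hU⟩ := h
  refine ⟨U, fun g hg => ?_⟩
  ext1 w
  obtain ⟨v, rfl⟩ := e.toAddEquiv.surjective w
  rw [← e.rep, hU g hg]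
  rfl

/-- Semilinear isomorphisms carry intertwining maps to intertwining maps. -/
noncomputable def homEquiv (e : TwistEquiv σ ρ τ) (e' : TwistEquiv σ υ ξ) :
    Representation.IntertwiningMap ρ υ ≃+ Representation.IntertwiningMap τ ξ where
  toFun f := LinearMap.intertwiningMap_of_isIntertwiningMap τ ξ
    { toFun := fun w => e'.toAddEquiv (f (e.toAddEquiv.symm w))
      map_add' := fun a b => by simp
      map_smul' := fun c w => by
        have h := e.symm.smul c w
        change e.toAddEquiv.symm (c • w) = σ.symm c • e.toAddEquiv.symm w at h
        rw [h, map_smul, e'.smul, σ.apply_symm_apply]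
        rfl }
    (fun g w => by
      have h := e.symm.rep g w
      change e.toAddEquiv.symm (τ g w) = ρ g (e.toAddEquiv.symm w) at h
      change e'.toAddEquiv (f (e.toAddEquiv.symm (τ g w))) = _
      rw [h, f.isIntertwining, e'.rep]
      rfl)
  invFun f := LinearMap.intertwiningMap_of_isIntertwiningMap ρ υ
    { toFun := fun v => e'.toAddEquiv.symm (f (e.toAddEquiv v))
      map_add' := fun a b => by simp
      map_smul' := fun c v => by
        rw [e.smul, map_smul, AddEquiv.symm_apply_eq]
        change _ = e'.toAddEquiv (c • _)
        rw [e'.smul, AddEquiv.apply_symm_apply] }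
    (fun g v => by
      change e'.toAddEquiv.symm (f (e.toAddEquiv (ρ g v))) = υ g (e'.toAddEquiv.symm _)
      rw [e.rep, f.isIntertwining, AddEquiv.symm_apply_eq, e'.rep, AddEquiv.apply_symm_apply])
  left_inv f := by
    apply DFunLike.ext
    intro v
    change e'.toAddEquiv.symm (e'.toAddEquiv (f (e.toAddEquiv.symm (e.toAddEquiv v)))) = f v
    simp
  right_inv f := by
    apply DFunLike.ext
    intro v
    change e'.toAddEquiv (e'.toAddEquiv.symm (f (e.toAddEquiv (e.toAddEquiv.symm v)))) = f v
    simp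
  map_add' f f' := by
    apply DFunLike.ext
    intro v
    exact map_add e'.toAddEquiv _ _

theorem finrank_hom_eq (e : TwistEquiv σ ρ τ) (e' : TwistEquiv σ υ ξ) :
    Module.finrank (PadicAlgCl p) (Representation.IntertwiningMap ρ υ) =
      Module.finrank (PadicAlgCl p) (Representation.IntertwiningMap τ ξ) := by
  have := lift_rank_eq_of_equiv_equiv (σ : PadicAlgCl p → PadicAlgCl p) (e.homEquiv e')
    σ.bijective (fun c f => by
      apply DFunLike.ext
      intro w
      exact e'.smul c _)
  have h := congrArg Cardinal.toNat this
  rwa [Cardinal.toNat_lift, Cardinal.toNat_lift] at h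

theorem dim_eq {d d' : ℕ} {ρ : Representation (PadicAlgCl p) G (Fin d → PadicAlgCl p)}
    {τ : Representation (PadicAlgCl p) G (Fin d' → PadicAlgCl p)} (e : TwistEquiv σ ρ τ) :
    d = d' := by
  have := rank_eq_of_equiv_equiv (σ : PadicAlgCl p → PadicAlgCl p) e.toAddEquiv σ.bijective e.smul
  simpa using this

theorem act_eq [TopologicalSpace G] [IsTopologicalGroup G] (e : TwistEquiv σ ρ τ)
    (hρ : IsSmoothRep ρ) (hτ : IsSmoothRep τ) (a : LambdaInf p G) (v : V) :
    e.toAddEquiv (LambdaInf.act ρ hρ a v) = LambdaInf.act τ hτ a (e.toAddEquiv v) := by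
  let U := LambdaInf.repKernel ρ hρ
  have h1 : ∀ g ∈ U, ρ g = 1 := LambdaInf.rep_eq_one ρ hρ
  have h2 : ∀ g ∈ U, τ g = 1 := by
    intro g hg
    ext1 w
    obtain ⟨v, rfl⟩ := e.toAddEquiv.surjective w
    rw [← e.rep, h1 g hg]
    rfl
  rw [LambdaInf.act_apply ρ hρ U h1, LambdaInf.act_apply τ hτ U h2]
  refine LambdaInf.addHom_ext
    (f := (e.toAddEquiv.toAddMonoidHom.comp
      (LinearMap.applyₗ (R := PadicAlgCl p) v).toAddMonoidHom).comp
      (LambdaInf.actQuot ρ U h1).toAddMonoidHom)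
    (g := (LinearMap.applyₗ (R := PadicAlgCl p) (e.toAddEquiv v)).toAddMonoidHom.comp
      (LambdaInf.actQuot τ U h2).toAddMonoidHom) (fun g r => ?_) (a.1 U)
  change e.toAddEquiv (LambdaInf.actQuot ρ U h1 _ v) = LambdaInf.actQuot τ U h2 _ (e.toAddEquiv v)
  rw [LambdaInf.actQuot_single, LambdaInf.actQuot_single, e.smul, e.rep, AlgEquiv.commutes]

end TwistEquiv

/-! ### The representation ring and the Hom-description -/

section galTwist

variable {p : ℕ} [Fact p.Prime] {G : Type*} [Group G] {d : ℕ}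

/-- The representation on `Q̄_p ^ d` obtained by applying `σ` to the matrix entries. -/
noncomputable def galTwist (σ : GalQp p)
    (ρ : Representation (PadicAlgCl p) G (Fin d → PadicAlgCl p)) :
    Representation (PadicAlgCl p) G (Fin d → PadicAlgCl p) where
  toFun g :=
    { toFun := fun v => σ ∘ (ρ g (σ.symm ∘ v))
      map_add' := fun v w => by
        have : σ.symm ∘ (v + w) = σ.symm ∘ v + σ.symm ∘ w := by ext i; simp
        rw [this, map_add]
        ext i
        simp
      map_smul' := fun c v => by
        have : σ.symm ∘ (c • v) = σ.symm c • (σ.symm ∘ v) := by ext i; simp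
        rw [this, map_smul]
        ext i
        simp }
  map_one' := by
    ext1 v
    ext i
    simp
  map_mul' g h := by
    ext1 v
    ext i
    have : ∀ w : Fin d → PadicAlgCl p, σ.symm ∘ (σ ∘ w) = w := fun w => by ext i; simp
    simp [this]

/-- The coordinatewise application of `σ`. -/
noncomputable def galTwistEquiv (σ : GalQp p)
    (ρ : Representation (PadicAlgCl p) G (Fin d → PadicAlgCl p)) :
    TwistEquiv σ ρ (galTwist σ ρ) where
  toFun v := σ ∘ v
  invFun v := σ.symm ∘ v
  left_inv v := by ext i; simp
  right_inv v := by ext i; simp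
  map_add' v w := by ext i; simp
  map_smul' c v := by ext i; simp
  map_rep' g v := by
    have : σ.symm ∘ (σ ∘ v) = v := by ext i; simp
    change σ ∘ (ρ g v) = σ ∘ (ρ g (σ.symm ∘ (σ ∘ v)))
    rw [this]

end galTwist

/-- An irreducible `Q̄_p`-representation of `G` which is trivial on some open subgroup; it is finite
dimensional if `G` is compact, and we take `Q̄_p ^ dim` as its underlying vector space. -/
structure IrrRep (p : ℕ) [Fact p.Prime] (G : Type*) [Group G] [TopologicalSpace G] where
  /-- the dimension -/
  dim : ℕ
  /-- the representation -/
  ρ : Representation (PadicAlgCl p) G (Fin dim → PadicAlgCl p)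
  irreducible : ρ.IsIrreducible
  smooth : IsSmoothRep ρ

/-- Isomorphism of irreducible representations. -/
instance IrrRep.setoid (p : ℕ) [Fact p.Prime] (G : Type*) [Group G] [TopologicalSpace G] :
    Setoid (IrrRep p G) where
  r π π' := Nonempty (π.ρ.Equiv π'.ρ)
  iseqv :=
    { refl := fun π => ⟨(TwistEquiv.ofEquiv (p := p) (.refl π.ρ)).toRepEquiv⟩
      symm := fun ⟨e⟩ => ⟨e.symm⟩
      trans := fun ⟨e⟩ ⟨e'⟩ => ⟨e.trans e'⟩ }

/-- The set `Irr(G)` of isomorphism classes of irreducible `Q̄_p`-representations of `G` which are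
trivial on some open subgroup. -/
def Irr (p : ℕ) [Fact p.Prime] (G : Type*) [Group G] [TopologicalSpace G] : Type _ :=
  Quotient (IrrRep.setoid p G)

/-- The representation ring `R_G`, the free abelian group on `Irr(G)`. -/
abbrev RepRing (p : ℕ) [Fact p.Prime] (G : Type*) [Group G] [TopologicalSpace G] : Type _ :=
  FreeAbelianGroup (Irr p G)

namespace Irr

variable {p : ℕ} [Fact p.Prime] {G : Type*} [Group G] [TopologicalSpace G]

/-- The isomorphism class of an irreducible representation. -/
def mk (π : IrrRep p G) : Irr p G := Quotient.mk _ π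

/-- A representation in a given isomorphism class. -/
noncomputable def out (π : Irr p G) : IrrRep p G := Quotient.out (s := IrrRep.setoid p G) π

theorem mk_out (π : Irr p G) : mk π.out = π := Quotient.out_eq (s := IrrRep.setoid p G) π

theorem mk_eq_mk {π π' : IrrRep p G} : mk π = mk π' ↔ Nonempty (π.ρ.Equiv π'.ρ) :=
  Quotient.eq (r := IrrRep.setoid p G)

/-- The Galois twist of an irreducible representation. -/
noncomputable def twistRep (σ : GalQp p) (π : IrrRep p G) : IrrRep p G where
  dim := π.dim
  ρ := galTwist σ π.ρ
  irreducible := (galTwistEquiv σ π.ρ).isIrreducible π.irreducible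
  smooth := (galTwistEquiv σ π.ρ).isSmoothRep π.smooth

theorem mk_eq_mk_of_twist {σ τ : GalQp p} {V : Type*} [AddCommGroup V] [Module (PadicAlgCl p) V]
    {ρ : Representation (PadicAlgCl p) G V} {π π' : IrrRep p G} (h : σ = τ)
    (e : TwistEquiv σ ρ π.ρ) (e' : TwistEquiv τ ρ π'.ρ) : mk π = mk π' := by
  subst h
  have f := e.symm.trans e'
  rw [mul_inv_cancel] at f
  exact mk_eq_mk.2 ⟨f.toRepEquiv⟩

/-- The action of the absolute Galois group on `Irr(G)`. -/
noncomputable instance : MulAction (GalQp p) (Irr p G) where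
  smul σ := Quotient.map (twistRep σ) (fun π π' ⟨e⟩ => mk_eq_mk.1
    (mk_eq_mk_of_twist (mul_one σ).symm
    (galTwistEquiv σ π.ρ) ((TwistEquiv.ofEquiv e).trans (galTwistEquiv σ π'.ρ))))
  one_smul π := by
    induction π using Quotient.ind with
    | _ π =>
      exact mk_eq_mk_of_twist (π := twistRep 1 π) (π' := π) rfl (galTwistEquiv 1 π.ρ)
        (.ofEquiv (.refl π.ρ))
  mul_smul σ τ π := by
    induction π using Quotient.ind with
    | _ π =>
      exact mk_eq_mk_of_twist (π := twistRep (σ * τ) π) (π' := twistRep σ (twistRep τ π)) rfl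
        (galTwistEquiv (σ * τ) π.ρ)
        ((galTwistEquiv τ π.ρ).trans (galTwistEquiv σ (galTwist τ π.ρ)))

theorem smul_mk (σ : GalQp p) (π : IrrRep p G) : σ • mk π = mk (twistRep σ π) := rfl

theorem nonempty_twistEquiv (σ : GalQp p) (π : Irr p G) :
    Nonempty (TwistEquiv σ π.out.ρ (σ • π).out.ρ) := by
  have h : mk (twistRep σ π.out) = mk (σ • π).out := by
    rw [mk_out, ← smul_mk, mk_out]
  obtain ⟨e⟩ := mk_eq_mk.1 h
  have f := (galTwistEquiv σ π.out.ρ).trans (.ofEquiv e)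
  rw [one_mul] at f
  exact ⟨f⟩

end Irr

section RepRing

variable {p : ℕ} [Fact p.Prime] {G : Type*} [Group G] [TopologicalSpace G]

/-- The class `[V] = ∑ m_π π` in `R_G` of a finite dimensional representation `V` which is trivial
on some open subgroup, where `m_π = dim Hom_G(π, V)` is the multiplicity of `π` in `V`. -/
noncomputable def repClass {V : Type*} [AddCommGroup V] [Module (PadicAlgCl p) V]
    (ρ : Representation (PadicAlgCl p) G V) : RepRing p G :=
  ∑ᶠ π : Irr p G, Module.finrank (PadicAlgCl p) (Representation.IntertwiningMap π.out.ρ ρ) •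
    FreeAbelianGroup.of π

/-- The action of the absolute Galois group on `R_G`. -/
noncomputable def galAct (σ : GalQp p) : RepRing p G →+ RepRing p G :=
  FreeAbelianGroup.map (fun π : Irr p G => σ • π)

theorem galAct_of (σ : GalQp p) (π : Irr p G) :
    galAct σ (FreeAbelianGroup.of π) = FreeAbelianGroup.of (σ • π) :=
  FreeAbelianGroup.map_of_apply _

theorem galAct_repClass (σ : GalQp p) {V W : Type*} [AddCommGroup V] [Module (PadicAlgCl p) V]
    [AddCommGroup W] [Module (PadicAlgCl p) W] {ρ : Representation (PadicAlgCl p) G V}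
    {τ : Representation (PadicAlgCl p) G W} (e : TwistEquiv σ ρ τ) :
    galAct σ (repClass ρ) = repClass τ := by
  have hinj : Function.Injective (galAct (G := G) σ) := by
    apply Function.LeftInverse.injective (g := galAct σ⁻¹)
    intro x
    have : (galAct σ⁻¹).comp (galAct (G := G) σ) = AddMonoidHom.id _ := by
      ext π
      simp [galAct_of]
    exact DFunLike.congr_fun this x
  rw [repClass, AddMonoidHom.map_finsum_of_injective _ hinj, repClass]
  refine Eq.trans (finsum_congr fun π => ?_)
    (finsum_comp_equiv (MulAction.toPerm (β := Irr p G) σ))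
  obtain ⟨f⟩ := π.nonempty_twistEquiv σ
  rw [map_nsmul, galAct_of, f.finrank_hom_eq e]
  rfl

/-- The representation of `G` on `V ⊗ ℚ_p[G/H]` with the diagonal action. -/
noncomputable def tensorQuotient {V : Type*} [AddCommGroup V] [Module (PadicAlgCl p) V]
    [Module ℚ_[p] V] [IsScalarTower ℚ_[p] (PadicAlgCl p) V] (H : Subgroup G)
    (ρ : Representation (PadicAlgCl p) G V) :
    Representation (PadicAlgCl p) G (V ⊗[ℚ_[p]] MonoidAlgebra ℚ_[p] (G ⧸ H)) where
  toFun g := TensorProduct.AlgebraTensorModule.map (ρ g)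
    (Representation.ofMulAction ℚ_[p] G (G ⧸ H) g)
  map_one' := by
    rw [map_one, map_one]
    exact TensorProduct.AlgebraTensorModule.map_one
  map_mul' g h := by
    rw [map_mul, map_mul]
    exact TensorProduct.AlgebraTensorModule.map_mul _ _ _ _

/-- The operator `ι` on `R_G` attached to `H`: `ι[V] = [V ⊗ ℚ_p[G/H]]`. -/
noncomputable def iota (p : ℕ) [Fact p.Prime] (H : Subgroup G) : RepRing p G →+ RepRing p G :=
  FreeAbelianGroup.lift fun π => repClass (tensorQuotient H π.out.ρ)

/-- The restriction `R_G → R_H`. -/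
noncomputable def resRep (p : ℕ) [Fact p.Prime] (H : Subgroup G) : RepRing p G →+ RepRing p H :=
  FreeAbelianGroup.lift fun π => repClass (π.out.ρ.comp H.subtype)

/-- The induction `R_H → R_G`. -/
noncomputable def indRep (p : ℕ) [Fact p.Prime] (H : Subgroup G) : RepRing p H →+ RepRing p G :=
  FreeAbelianGroup.lift fun π => repClass (Representation.ind H.subtype π.out.ρ)

/-- The group `Hom_𝒢(R_G, Q̄_pˣ)` of homomorphisms which are equivariant for the absolute Galois
group `𝒢` of `ℚ_p`; the addition of `R_G` is written multiplicatively. -/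
noncomputable def GalHom (p : ℕ) [Fact p.Prime] (G : Type*) [Group G] [TopologicalSpace G] :
    Subgroup (Multiplicative (RepRing p G) →* (PadicAlgCl p)ˣ) where
  carrier := {f | ∀ (σ : GalQp p) (x : RepRing p G),
    f (.ofAdd (galAct σ x)) = Units.map (σ : PadicAlgCl p →* PadicAlgCl p) (f (.ofAdd x))}
  mul_mem' hf hg σ x := by
    rw [MonoidHom.mul_apply, MonoidHom.mul_apply, map_mul, hf, hg]
  one_mem' σ x := by simp
  inv_mem' hf σ x := by
    rw [MonoidHom.inv_apply, MonoidHom.inv_apply, map_inv, hf]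

/-- The semilinear isomorphism between `V ⊗ ℚ_p[G/H]` and its twist. -/
noncomputable def TwistEquiv.tensorQuotient {V W : Type*} [AddCommGroup V]
    [Module (PadicAlgCl p) V] [Module ℚ_[p] V] [IsScalarTower ℚ_[p] (PadicAlgCl p) V]
    [AddCommGroup W] [Module (PadicAlgCl p) W] [Module ℚ_[p] W]
    [IsScalarTower ℚ_[p] (PadicAlgCl p) W] {σ : GalQp p} (H : Subgroup G)
    {ρ : Representation (PadicAlgCl p) G V} {τ : Representation (PadicAlgCl p) G W}
    (e : TwistEquiv σ ρ τ) :
    TwistEquiv σ (_root_.tensorQuotient H ρ) (_root_.tensorQuotient H τ) :=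
  let E : V ≃ₗ[ℚ_[p]] W :=
    { e.toAddEquiv with
      map_smul' := fun c v => by
        change e.toAddEquiv (c • v) = c • e.toAddEquiv v
        rw [← algebraMap_smul (PadicAlgCl p) c v, e.smul, AlgEquiv.commutes, algebraMap_smul] }
  have hE : ∀ v, E v = e.toAddEquiv v := fun _ => rfl
  let T := TensorProduct.congr E (LinearEquiv.refl ℚ_[p] (MonoidAlgebra ℚ_[p] (G ⧸ H)))
  { T.toAddEquiv with
    map_smul' := fun c x => by
      change T (c • x) = σ c • T x
      induction x with
      | zero => simp
      | add x y hx hy => simp only [smul_add, map_add, hx, hy]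
      | tmul v a =>
        rw [TensorProduct.smul_tmul']
        simp only [T, TensorProduct.congr_tmul, TensorProduct.smul_tmul', hE, e.smul]
    map_rep' := fun g x => by
      change T (_root_.tensorQuotient H ρ g x) = _root_.tensorQuotient H τ g (T x)
      induction x with
      | zero => simp
      | add x y hx hy => simp only [map_add, hx, hy]
      | tmul v a =>
        simp only [T, _root_.tensorQuotient, MonoidHom.coe_mk, OneHom.coe_mk,
          TensorProduct.AlgebraTensorModule.map_tmul, TensorProduct.congr_tmul, hE, e.rep,
          LinearEquiv.refl_apply] }

theorem galAct_iota (H : Subgroup G) (σ : GalQp p) (x : RepRing p G) :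
    iota p H (galAct σ x) = galAct σ (iota p H x) := by
  have : (iota p H).comp (galAct σ) = (galAct σ).comp (iota p H) := by
    ext π
    obtain ⟨e⟩ := π.nonempty_twistEquiv σ
    simp only [AddMonoidHom.comp_apply, galAct_of, iota, FreeAbelianGroup.lift_apply_of]
    exact (galAct_repClass σ (e.tensorQuotient H)).symm
  exact DFunLike.congr_fun this x

/-- The adjoint `Hom_𝒢(ι, Q̄_pˣ)` of the operator `ι`. -/
noncomputable def iotaAdjoint (p : ℕ) [Fact p.Prime] (H : Subgroup G) :
    GalHom p G →* GalHom p G where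
  toFun f := ⟨f.1.comp (iota p H).toMultiplicative, fun σ x => by
    change f.1 (.ofAdd (iota p H (galAct σ x))) = _
    rw [galAct_iota, f.2]
    rfl⟩
  map_one' := rfl
  map_mul' _ _ := rfl

theorem repRing_hom_ext {f g : Multiplicative (RepRing p G) →* (PadicAlgCl p)ˣ}
    (h : ∀ π : Irr p G, f (.ofAdd (FreeAbelianGroup.of π)) = g (.ofAdd (FreeAbelianGroup.of π))) :
    f = g := by
  apply MonoidHom.toAdditiveRight.injective
  ext π
  exact congrArg Units.val (h π)

end RepRing

section HomDescription

variable {p : ℕ} [Fact p.Prime] {G : Type*} [Group G] [TopologicalSpace G] [IsTopologicalGroup G]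

theorem det_act_twist {d d' : ℕ} {σ : GalQp p}
    {ρ : Representation (PadicAlgCl p) G (Fin d → PadicAlgCl p)}
    {τ : Representation (PadicAlgCl p) G (Fin d' → PadicAlgCl p)} (e : TwistEquiv σ ρ τ)
    (hρ : IsSmoothRep ρ) (hτ : IsSmoothRep τ) (x : K1 (LambdaInf p G)) :
    LambdaInf.det τ hτ x =
      Units.map (σ : PadicAlgCl p →* PadicAlgCl p) (LambdaInf.det ρ hρ x) := by
  obtain rfl := e.dim_eq
  obtain ⟨n, g, rfl⟩ := K1.exists_of x
  let fρ :=
    (LinearMap.toMatrixAlgEquiv' (R := PadicAlgCl p) (n := Fin d)).toRingEquiv.toRingHom.comp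
    (LambdaInf.act ρ hρ)
  let fτ :=
    (LinearMap.toMatrixAlgEquiv' (R := PadicAlgCl p) (n := Fin d)).toRingEquiv.toRingHom.comp
    (LambdaInf.act τ hτ)
  have hfρ : ∀ a v, (fρ a).mulVec v = LambdaInf.act ρ hρ a v := fun a v =>
    LinearMap.toMatrix'_mulVec _ _
  have hfτ : ∀ a v, (fτ a).mulVec v = LambdaInf.act τ hτ a v := fun a v =>
    LinearMap.toMatrix'_mulVec _ _
  let E : Matrix (Fin d) (Fin d) (PadicAlgCl p) :=
    Matrix.of fun i j => e.toAddEquiv (Pi.single j 1) i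
  have hE : ∀ v : Fin d → PadicAlgCl p, E.mulVec (σ ∘ v) = e.toAddEquiv v := by
    intro v
    have hv : v = ∑ j, v j • (Pi.single j 1 : Fin d → PadicAlgCl p) := by
      ext i
      simp [Finset.sum_apply, Pi.single_apply]
    conv_rhs => rw [hv, map_sum]
    ext i
    simp only [e.smul, Matrix.mulVec, dotProduct, Finset.sum_apply, Pi.smul_apply, smul_eq_mul]
    exact Finset.sum_congr rfl fun j _ => mul_comm _ _
  have hcomm : ∀ a, fτ a * E = E * (fρ a).map σ := by
    intro a
    ext i j
    have h1 := e.act_eq hρ hτ a (Pi.single j 1)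
    rw [← hE, ← hfτ, ← hfρ, Matrix.mulVec_single_one] at h1
    exact (congrFun h1 i).symm
  let F : Matrix (Fin d) (Fin d) (PadicAlgCl p) :=
    Matrix.of fun i j => σ (e.toAddEquiv.symm (Pi.single j 1) i)
  have hEF : E * F = 1 := by
    ext i j
    have h1 := hE (e.toAddEquiv.symm (Pi.single j 1))
    rw [AddEquiv.apply_symm_apply] at h1
    rw [Matrix.one_apply, ← Pi.single_apply j (1 : PadicAlgCl p) i]
    exact congrFun h1 i
  let Φ := Matrix.compRingEquiv (Fin n) (Fin d) (PadicAlgCl p)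
  have hD : (Φ (Matrix.diagonal fun _ => E)).det ≠ 0 := by
    have h1 : Φ (Matrix.diagonal fun _ => E) * Φ (Matrix.diagonal fun _ => F) = 1 := by
      rw [← map_mul, Matrix.diagonal_mul_diagonal, hEF, Matrix.diagonal_one, map_one]
    have h2 := congrArg Matrix.det h1
    rw [Matrix.det_mul, Matrix.det_one] at h2
    exact left_ne_zero_of_mul_eq_one h2
  have hblock : K1.blockRep fτ n g.1 * Φ (Matrix.diagonal fun _ => E) =
      Φ (Matrix.diagonal fun _ => E) * (K1.blockRep fρ n g.1).map σ := by
    have h1 : (K1.blockRep fρ n g.1).map σ = Φ (Matrix.of fun i j => (fρ (g.1 i j)).map σ) := rfl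
    have h2 : K1.blockRep fτ n g.1 = Φ (Matrix.of fun i j => fτ (g.1 i j)) := rfl
    rw [h1, h2, ← map_mul, ← map_mul]
    congr 1
    ext1 i j
    rw [Matrix.mul_diagonal, Matrix.diagonal_mul]
    exact hcomm _
  have hdet := congrArg Matrix.det hblock
  rw [Matrix.det_mul, Matrix.det_mul, mul_comm] at hdet
  ext
  change (K1.blockRep fτ n g.1).det = σ (K1.blockRep fρ n g.1).det
  rw [mul_left_cancel₀ hD hdet]
  exact (RingHom.map_det (σ : PadicAlgCl p →+* PadicAlgCl p) _).symm

/-- The homomorphism `[V] ↦ det(x ; V)` on `R_G`, for `x` in `K₁(Λ^∞(G))`. -/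
noncomputable def detRep (x : K1 (LambdaInf p G)) :
    Multiplicative (RepRing p G) →* (PadicAlgCl p)ˣ :=
  AddMonoidHom.toMultiplicativeLeft (FreeAbelianGroup.lift fun π : Irr p G =>
    Additive.ofMul (LambdaInf.det π.out.ρ π.out.smooth x))

theorem detRep_of (x : K1 (LambdaInf p G)) (π : Irr p G) :
    detRep x (.ofAdd (FreeAbelianGroup.of π)) = LambdaInf.det π.out.ρ π.out.smooth x := by
  change (FreeAbelianGroup.lift _ (FreeAbelianGroup.of π) : Additive (PadicAlgCl p)ˣ).toMul = _
  rw [FreeAbelianGroup.lift_apply_of]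
  rfl

theorem detRep_galAct (x : K1 (LambdaInf p G)) (σ : GalQp p) (y : RepRing p G) :
    detRep x (.ofAdd (galAct σ y)) =
      Units.map (σ : PadicAlgCl p →* PadicAlgCl p) (detRep x (.ofAdd y)) := by
  have key : (detRep x).comp (galAct σ).toMultiplicative =
      (Units.map (σ : PadicAlgCl p →* PadicAlgCl p)).comp (detRep x) := by
    refine repRing_hom_ext fun π => ?_
    obtain ⟨e⟩ := π.nonempty_twistEquiv σ
    have h1 : detRep x (.ofAdd (galAct σ (FreeAbelianGroup.of π))) =
        LambdaInf.det (σ • π).out.ρ (σ • π).out.smooth x := by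
      rw [galAct_of, detRep_of]
    have h2 := det_act_twist e π.out.smooth (σ • π).out.smooth x
    rw [← detRep_of x π] at h2
    exact h1.trans h2
  have h3 := DFunLike.congr_fun key (Multiplicative.ofAdd y)
  rw [MonoidHom.comp_apply, MonoidHom.comp_apply] at h3
  exact h3

/-- The Hom-description `K₁(Λ^∞(G)) → Hom_𝒢(R_G, Q̄_pˣ)`, `[a] ↦ ([V] ↦ det(a · ; V))`. -/
noncomputable def homDescription (p : ℕ) [Fact p.Prime] (G : Type*) [Group G] [TopologicalSpace G]
    [IsTopologicalGroup G] : K1 (LambdaInf p G) →* GalHom p G where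
  toFun x := ⟨detRep x, detRep_galAct x⟩
  map_one' := Subtype.ext (repRing_hom_ext fun π => by
    rw [detRep_of, map_one]
    rfl)
  map_mul' x y := Subtype.ext (repRing_hom_ext fun π => by
    rw [detRep_of, map_mul, ← detRep_of, ← detRep_of]
    rfl)

/-- The norm operator `K₁(Λ^∞(G)) → K₁(Λ^∞(H)) → K₁(Λ^∞(G))`, the transfer followed by the
canonical map, for an open subgroup `H` of `G`. -/
noncomputable def normOp (p : ℕ) [Fact p.Prime] [CompactSpace G] (H : Subgroup G)
    (hH : IsOpen (H : Set G)) : K1 (LambdaInf p G) →* K1 (LambdaInf p G) :=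
  (K1.map (LambdaInf.can p H)).comp
    (K1.transfer (LambdaInf.can p H) (LambdaInf.rightFree_can p hH))

end HomDescription

end Representations

/-! ### The `p`-th power map of a `p`-adic Lie group -/

open scoped Manifold ContDiff

/-- In a `p`-adic Lie group the image of the `p`-th power map is a neighbourhood of `1`: in a chart,
this map has the invertible derivative `p` at the identity. -/
theorem range_pow_mem_nhds (p : ℕ) [Fact p.Prime] (d : ℕ) {G : Type*} [Group G]
    [TopologicalSpace G] [ChartedSpace (Fin d → ℚ_[p]) G]
    [LieGroup 𝓘(ℚ_[p], Fin d → ℚ_[p]) ω G] : Set.range (fun g : G => g ^ p) ∈ nhds (1 : G) := by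
  let I := 𝓘(ℚ_[p], Fin d → ℚ_[p])
  have : IsTopologicalGroup G := topologicalGroup_of_lieGroup I ω
  let φ := extChartAt I (1 : G)
  let e := φ 1
  have he : φ.symm e = 1 := extChartAt_to_inv (I := I) (1 : G)
  have hsymm : ContinuousAt φ.symm e := continuousAt_extChartAt_symm (I := I) (1 : G)
  have hright : ∀ᶠ x in nhds e, φ (φ.symm x) = x := by
    filter_upwards [extChartAt_target_mem_nhds (I := I) (1 : G)] with x hx
    exact φ.right_inv hx
  have hleft : ∀ᶠ g in nhds (1 : G), φ.symm (φ g) = g := by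
    filter_upwards [extChartAt_source_mem_nhds (I := I) (1 : G)] with g hg
    exact φ.left_inv hg
  let M : (Fin d → ℚ_[p]) × (Fin d → ℚ_[p]) → (Fin d → ℚ_[p]) :=
    fun z => φ (φ.symm z.1 * φ.symm z.2)
  have hM : ContDiffAt ℚ_[p] ω M (e, e) := by
    have h := (contMDiff_mul I ω (G := G)).contMDiffAt (x := ((1 : G), (1 : G)))
    rw [contMDiffAt_iff_of_mem_source (x := ((1 : G), (1 : G))) (y := (1 : G))
      (mem_chart_source _ _) (by simp)] at h
    have hrange : Set.range (I.prod I) = Set.univ := by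
      rw [modelWithCorners_prod_coe, Set.range_prodMap]
      simp [I]
    have h2 := h.2
    rw [hrange, contDiffWithinAt_univ] at h2
    exact h2
  have hMs := hM.analyticAt.hasStrictFDerivAt
  set M' := fderiv ℚ_[p] M (e, e) with hM'
  have hl : ∀ v, M' (v, 0) = v := by
    have h1 : HasFDerivAt (fun x => M (x, e)) (M'.comp (ContinuousLinearMap.inl _ _ _)) e :=
      HasFDerivAt.comp (f := fun x => (x, e)) e hMs.hasFDerivAt
        (hasFDerivAt_prodMk_left (𝕜 := ℚ_[p]) e e)
    have h2 : HasFDerivAt (fun x => M (x, e)) (ContinuousLinearMap.id ℚ_[p] (Fin d → ℚ_[p])) e :=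
      (hasFDerivAt_id e).congr_of_eventuallyEq (by
        filter_upwards [hright] with x hx
        simp [M, he, hx])
    intro v
    simpa using congrArg (fun T => T v) (h1.unique h2)
  have hr : ∀ v, M' (0, v) = v := by
    have h1 : HasFDerivAt (fun x => M (e, x)) (M'.comp (ContinuousLinearMap.inr _ _ _)) e :=
      HasFDerivAt.comp (f := fun x => (e, x)) e hMs.hasFDerivAt
        (hasFDerivAt_prodMk_right (𝕜 := ℚ_[p]) e e)
    have h2 : HasFDerivAt (fun x => M (e, x)) (ContinuousLinearMap.id ℚ_[p] (Fin d → ℚ_[p])) e :=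
      (hasFDerivAt_id e).congr_of_eventuallyEq (by
        filter_upwards [hright] with x hx
        simp [M, he, hx])
    intro v
    simpa using congrArg (fun T => T v) (h1.unique h2)
  have hpow : ∀ n : ℕ, HasStrictFDerivAt (fun x => φ (φ.symm x ^ n))
      ((n : ℚ_[p]) • ContinuousLinearMap.id ℚ_[p] (Fin d → ℚ_[p])) e := by
    intro n
    induction n with
    | zero => simpa using hasStrictFDerivAt_const (𝕜 := ℚ_[p]) (φ 1) e
    | succ n ih =>
      have hMe : HasStrictFDerivAt M M' ((fun x => (φ (φ.symm x ^ n), x)) e) := by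
        simpa [he] using! hMs
      have hc := HasStrictFDerivAt.comp (f := fun x => (φ (φ.symm x ^ n), x)) e hMe
        (ih.prodMk (hasStrictFDerivAt_id e))
      have hd : M'.comp (((n : ℚ_[p]) • ContinuousLinearMap.id ℚ_[p] (Fin d → ℚ_[p])).prod
          (ContinuousLinearMap.id ℚ_[p] (Fin d → ℚ_[p]))) =
          ((n + 1 : ℕ) : ℚ_[p]) • ContinuousLinearMap.id ℚ_[p] (Fin d → ℚ_[p]) := by
        ext1 v
        have : ((n : ℚ_[p]) • v, v) = ((n : ℚ_[p]) • v, (0 : Fin d → ℚ_[p])) + (0, v) := by simp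
        simp only [ContinuousLinearMap.comp_apply, ContinuousLinearMap.prod_apply,
          smul_apply, ContinuousLinearMap.id_apply, this, map_add, hl, hr]
        push_cast
        rw [add_smul, one_smul]
      rw [hd] at hc
      refine hc.congr_of_eventuallyEq ?_
      have hcn : ContinuousAt (fun x => φ.symm x ^ n) e := hsymm.pow n
      have h1 : Filter.Tendsto (fun x => φ.symm x ^ n) (nhds e) (nhds 1) := by
        simpa [ContinuousAt, he] using hcn
      filter_upwards [h1.eventually hleft] with x hx
      simp [M, hx, pow_succ]
  have hp : (p : ℚ_[p]) ≠ 0 := by exact_mod_cast (Fact.out : p.Prime).ne_zero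
  let E : (Fin d → ℚ_[p]) ≃L[ℚ_[p]] (Fin d → ℚ_[p]) :=
    ContinuousLinearEquiv.smulLeft (Units.mk0 _ hp)
  have hE : (E : (Fin d → ℚ_[p]) →L[ℚ_[p]] (Fin d → ℚ_[p])) =
      (p : ℚ_[p]) • ContinuousLinearMap.id ℚ_[p] (Fin d → ℚ_[p]) := by
    ext1 v
    rfl
  have hopen := HasStrictFDerivAt.map_nhds_eq_of_equiv (f' := E) (by rw [hE]; exact hpow p)
  have hval : φ (φ.symm e ^ p) = e := by simp [he, e]
  rw [hval] at hopen
  have hev : ∀ᶠ x in nhds e, φ.symm x ∈ Set.range (fun g : G => g ^ p) := by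
    rw [← hopen, Filter.eventually_map]
    have h1 : Filter.Tendsto (fun x => φ.symm x ^ p) (nhds e) (nhds 1) := by
      have h0 : ContinuousAt (fun x => φ.symm x ^ p) e := hsymm.pow p
      simpa [ContinuousAt, he] using h0
    filter_upwards [h1.eventually hleft] with x hx
    exact ⟨φ.symm x, hx.symm⟩
  have hφ : Filter.Tendsto φ (nhds 1) (nhds e) := continuousAt_extChartAt (I := I) (1 : G)
  filter_upwards [hφ.eventually hev, hleft] with g hg hg'
  rwa [hg'] at hg


/-- In a `p`-adic Lie group, a subgroup of the form `{g ^ p}` is open. -/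
theorem isOpen_of_coe_eq_range_pow (p : ℕ) [Fact p.Prime] (d : ℕ) {G : Type*} [Group G]
    [TopologicalSpace G] [ChartedSpace (Fin d → ℚ_[p]) G]
    [LieGroup 𝓘(ℚ_[p], Fin d → ℚ_[p]) ω G] {P : Subgroup G}
    (hP : (P : Set G) = Set.range fun g : G => g ^ p) : IsOpen (P : Set G) := by
  have : IsTopologicalGroup G := topologicalGroup_of_lieGroup 𝓘(ℚ_[p], Fin d → ℚ_[p]) ω
  exact P.isOpen_of_mem_nhds (hP ▸ range_pow_mem_nhds p d)

/-!
Write `H` for an open subgroup of the compact group `G`.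

A smooth representation of `G` factors through a finite quotient, so it is a direct sum of
irreducible ones by Maschke's theorem, and by Schur's lemma its class in `R_G`, defined by the
dimensions of spaces of intertwining maps, is the sum of the classes of the summands. Hence a
statement about classes of smooth representations can be proved by adding one irreducible summand
at a time (`IsSmoothRep.induction`). This gives that the class of an induced representation depends
only on the class of the inducing one (`indRep_repClass`), and that `Det` evaluated at the class of
any representation `V` is the determinant on `V` (`detRep_repClass`).

The first assertion is then the isomorphism `Ind (Res V) ≅ V ⊗ ℚ_p[G/H]`, `h ⊗ v ↦ h⁻¹ v ⊗ h⁻¹ H`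
(`indResEquivTensor`).

For the second one, let `A = Λ^∞(G)` and `B = Λ^∞(H)`. The transfer sends a matrix over `A` to the
matrix over `B` of the action of `A` on itself in a right `B`-basis, so the determinant of the norm
on `V` is the determinant of the original matrix on `A ⊗_B V`, and this `A`-module is
`V ⊗ ℚ_p[G/H]`. The tensor product over the noncommutative ring `B` is not constructed. Instead a
basis `b` of `A` is used to map `V ^ m` to `U = V ⊗ ℚ_p[G/H]` by `(v i) ↦ ∑ i, b i (v i ⊗ H)`. This
map commutes with the actions of `A` for every basis; it is bijective for a basis of coset
representatives, and therefore for every basis (`K1.IsRightBasis.bijective_basisMap`), in particular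
for the unspecified one in the definition of the transfer.
-/

/-! ### Decomposition of smooth representations -/

section Representation

variable {p : ℕ} [Fact p.Prime] {G : Type*} [Group G]
  {V W X Y : Type*} [AddCommGroup V] [Module (PadicAlgCl p) V] [AddCommGroup W]
  [Module (PadicAlgCl p) W] [AddCommGroup X] [Module (PadicAlgCl p) X] [AddCommGroup Y]
  [Module (PadicAlgCl p) Y]

/-- The direct sum of two isomorphisms of representations. -/
noncomputable def Representation.Equiv.prodCongr {ρ : Representation (PadicAlgCl p) G V}
    {σ : Representation (PadicAlgCl p) G W} {τ : Representation (PadicAlgCl p) G X}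
    {υ : Representation (PadicAlgCl p) G Y} (e : ρ.Equiv σ) (e' : τ.Equiv υ) :
    (ρ.prod τ).Equiv (σ.prod υ) :=
  .mk (e.toLinearEquiv.prodCongr e'.toLinearEquiv) fun g => LinearMap.ext fun v => Prod.ext
    (e.toIntertwiningMap.isIntertwining _ _ g v.1) (e'.toIntertwiningMap.isIntertwining _ _ g v.2)

/-- A finite dimensional representation, transported to a coordinate space. -/
theorem exists_equiv_fin [FiniteDimensional (PadicAlgCl p) V]
    (ρ : Representation (PadicAlgCl p) G V) :
    ∃ τ : Representation (PadicAlgCl p) G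
      (Fin (Module.finrank (PadicAlgCl p) V) → PadicAlgCl p), Nonempty (ρ.Equiv τ) := by
  let e : V ≃ₗ[PadicAlgCl p] (Fin (Module.finrank (PadicAlgCl p) V) → PadicAlgCl p) :=
    (Module.finBasis (PadicAlgCl p) V).equivFun
  refine ⟨(e.conjRingEquiv : Module.End _ V →* Module.End _ _).comp ρ,
    ⟨.mk e fun g => LinearMap.ext fun v => ?_⟩⟩
  change e (ρ g v) = e (ρ g (e.symm (e v)))
  rw [LinearEquiv.symm_apply_apply]

/-- Complementary subrepresentations decompose a representation as a direct sum. -/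
noncomputable def Subrepresentation.prodEquiv {ρ : Representation (PadicAlgCl p) G V}
    {N N' : Subrepresentation ρ} (h : IsCompl N.toSubmodule N'.toSubmodule) :
    (N.toRepresentation.prod N'.toRepresentation).Equiv ρ :=
  .mk (Submodule.prodEquivOfIsCompl _ _ h) fun g => LinearMap.ext fun v => by
    change ρ g v.1 + ρ g v.2 = ρ g (v.1 + v.2)
    rw [map_add]

/-- A minimal nonzero subrepresentation is irreducible. -/
theorem Subrepresentation.isIrreducible_of_isAtom {ρ : Representation (PadicAlgCl p) G V}
    {N : Subrepresentation ρ} (hN : IsAtom N) : N.toRepresentation.IsIrreducible := by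
  have hmem : ∀ {M : Subrepresentation ρ}, M ≠ ⊥ → ∃ v ∈ M, v ≠ 0 := by
    intro M hM
    by_contra! h
    exact hM (le_antisymm (fun v hv => (Submodule.mem_bot _).2 (h v hv)) bot_le)
  let incl : Subrepresentation N.toRepresentation → Subrepresentation ρ := fun M =>
    { toSubmodule := M.toSubmodule.map N.toSubmodule.subtype
      apply_mem_toSubmodule := by
        rintro g _ ⟨v, hv, rfl⟩
        exact ⟨N.toRepresentation g v, M.apply_mem_toSubmodule g hv, rfl⟩ }
  have hincl : ∀ M (v : N.toSubmodule), v.1 ∈ incl M ↔ v ∈ M := by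
    intro M v
    constructor
    · rintro ⟨w, hw, hwv⟩
      rwa [← Subtype.ext hwv]
    · intro hv
      exact ⟨v, hv, rfl⟩
  refine { exists_pair_ne := ⟨⊥, ⊤, fun h => ?_⟩, eq_bot_or_eq_top := fun M => ?_ }
  · obtain ⟨v, hv, hv0⟩ := hmem hN.1
    have h1 : (⟨v, hv⟩ : N.toSubmodule) ∈ (⊥ : Subrepresentation N.toRepresentation) := by
      rw [h]
      exact Submodule.mem_top
    exact hv0 (congrArg Subtype.val ((Submodule.mem_bot _).1 h1))
  · have hle : incl M ≤ N := by
      rintro _ ⟨w, -, rfl⟩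
      exact w.2
    rcases hN.le_iff.1 hle with h | h
    · left
      refine le_antisymm (fun v hv => ?_) bot_le
      have h1 := (hincl M v).2 hv
      rw [h] at h1
      exact (Submodule.mem_bot _).2 (Subtype.ext ((Submodule.mem_bot _).1 h1))
    · right
      refine le_antisymm le_top (fun v _ => (hincl M v).1 ?_)
      rw [h]
      exact v.2

theorem finrank_intertwiningMap_congr {τ : Representation (PadicAlgCl p) G X}
    {ρ : Representation (PadicAlgCl p) G V} {σ : Representation (PadicAlgCl p) G W}
    (e : ρ.Equiv σ) : Module.finrank (PadicAlgCl p) (Representation.IntertwiningMap τ ρ) =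
      Module.finrank (PadicAlgCl p) (Representation.IntertwiningMap τ σ) :=
  (TwistEquiv.ofEquiv (.refl τ)).finrank_hom_eq (TwistEquiv.ofEquiv e)

/-- Intertwining maps into a direct sum are pairs of intertwining maps. -/
noncomputable def Representation.IntertwiningMap.prodEquiv
    (τ : Representation (PadicAlgCl p) G X) (ρ : Representation (PadicAlgCl p) G V)
    (σ : Representation (PadicAlgCl p) G W) :
    (IntertwiningMap τ ρ × IntertwiningMap τ σ) ≃ₗ[PadicAlgCl p] IntertwiningMap τ (ρ.prod σ) where
  toFun f := f.1.prod f.2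
  invFun f := ((fst _ ρ σ).comp f, (snd _ ρ σ).comp f)
  map_add' _ _ := rfl
  map_smul' _ _ := rfl
  left_inv _ := rfl
  right_inv _ := rfl

theorem finrank_intertwiningMap_prod [FiniteDimensional (PadicAlgCl p) V]
    [FiniteDimensional (PadicAlgCl p) W] [FiniteDimensional (PadicAlgCl p) X]
    (τ : Representation (PadicAlgCl p) G X) (ρ : Representation (PadicAlgCl p) G V)
    (σ : Representation (PadicAlgCl p) G W) :
    Module.finrank (PadicAlgCl p) (Representation.IntertwiningMap τ (ρ.prod σ)) =
      Module.finrank (PadicAlgCl p) (Representation.IntertwiningMap τ ρ) +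
      Module.finrank (PadicAlgCl p) (Representation.IntertwiningMap τ σ) := by
  rw [← (Representation.IntertwiningMap.prodEquiv τ ρ σ).finrank_eq, Module.finrank_prod]

end Representation

section Smooth

variable {p : ℕ} [Fact p.Prime] {G : Type*} [Group G] [TopologicalSpace G]
  {V W : Type*} [AddCommGroup V] [Module (PadicAlgCl p) V] [AddCommGroup W]
  [Module (PadicAlgCl p) W]

theorem IsSmoothRep.of_equiv {ρ : Representation (PadicAlgCl p) G V}
    {σ : Representation (PadicAlgCl p) G W} (e : ρ.Equiv σ) (h : IsSmoothRep ρ) : IsSmoothRep σ :=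
  (TwistEquiv.ofEquiv e).isSmoothRep h

theorem IsSmoothRep.prod {ρ : Representation (PadicAlgCl p) G V}
    {σ : Representation (PadicAlgCl p) G W} (hρ : IsSmoothRep ρ) (hσ : IsSmoothRep σ) :
    IsSmoothRep (ρ.prod σ) := by
  obtain ⟨U, hU⟩ := hρ
  obtain ⟨U', hU'⟩ := hσ
  refine ⟨U ⊓ U', fun g hg => ?_⟩
  change (ρ g).prodMap (σ g) = 1
  rw [hU g hg.1, hU' g hg.2]
  exact LinearMap.prodMap_one

theorem IsSmoothRep.toRepresentation {ρ : Representation (PadicAlgCl p) G V}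
    (hρ : IsSmoothRep ρ) (N : Subrepresentation ρ) : IsSmoothRep N.toRepresentation := by
  obtain ⟨U, hU⟩ := hρ
  refine ⟨U, fun g hg => ?_⟩
  ext v
  change ρ g v = v
  rw [hU g hg]
  rfl

variable [IsTopologicalGroup G] [CompactSpace G]

/-- Maschke's theorem for smooth representations of a compact group: they factor through a finite
quotient. -/
theorem IsSmoothRep.exists_isCompl {ρ : Representation (PadicAlgCl p) G V} (hρ : IsSmoothRep ρ)
    (N : Subrepresentation ρ) :
    ∃ N' : Subrepresentation ρ, IsCompl N.toSubmodule N'.toSubmodule := by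
  let U := LambdaInf.repKernel ρ hρ
  have : Finite (G ⧸ U.toSubgroup) := Subgroup.quotient_finite_of_isOpen _ U.isOpen'
  let ρ' : Representation (PadicAlgCl p) (G ⧸ U.toSubgroup) V :=
    QuotientGroup.lift U.toSubgroup ρ (LambdaInf.rep_eq_one ρ hρ)
  have : NeZero (Nat.card (G ⧸ U.toSubgroup) : PadicAlgCl p) :=
    ⟨Nat.cast_ne_zero.2 Nat.card_pos.ne'⟩
  let M : Subrepresentation ρ' :=
    { toSubmodule := N.toSubmodule
      apply_mem_toSubmodule := by
        intro g v hv
        obtain ⟨g, rfl⟩ := QuotientGroup.mk_surjective g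
        exact N.apply_mem_toSubmodule g hv }
  obtain ⟨M', hM'⟩ := ComplementedLattice.exists_isCompl M
  refine ⟨⟨M'.toSubmodule, fun g v hv => M'.apply_mem_toSubmodule (g : G ⧸ U.toSubgroup) hv⟩, ?_⟩
  rw [isCompl_iff, disjoint_iff, codisjoint_iff]
  exact ⟨congrArg Subrepresentation.toSubmodule hM'.inf_eq_bot,
    congrArg Subrepresentation.toSubmodule hM'.sup_eq_top⟩

/-- A nonzero finite dimensional smooth representation is the sum of an irreducible one and of a
smooth one. -/
theorem IsSmoothRep.exists_irreducible_prod [FiniteDimensional (PadicAlgCl p) V] [Nontrivial V]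
    {ρ : Representation (PadicAlgCl p) G V} (hρ : IsSmoothRep ρ) :
    ∃ (π : IrrRep p G) (e : ℕ) (σ : Representation (PadicAlgCl p) G (Fin e → PadicAlgCl p)),
      IsSmoothRep σ ∧ e < Module.finrank (PadicAlgCl p) V ∧ Nonempty (ρ.Equiv (π.ρ.prod σ)) := by
  have hmono : StrictMono (Subrepresentation.toSubmodule (ρ := ρ)) := fun M M' h =>
    ⟨h.1, fun h' => h.2 h'⟩
  have : WellFoundedLT (Subrepresentation ρ) := hmono.wellFoundedLT
  obtain hbot | ⟨N, hN, -⟩ := IsAtomic.eq_bot_or_exists_atom_le (⊤ : Subrepresentation ρ)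
  · have : (⊤ : Submodule (PadicAlgCl p) V) = ⊥ := congrArg Subrepresentation.toSubmodule hbot
    exact absurd this.symm bot_ne_top
  obtain ⟨N', hN'⟩ := hρ.exists_isCompl N
  obtain ⟨τ, ⟨f⟩⟩ := exists_equiv_fin N.toRepresentation
  obtain ⟨σ, ⟨f'⟩⟩ := exists_equiv_fin N'.toRepresentation
  refine ⟨⟨_, τ, (TwistEquiv.ofEquiv f).isIrreducible
    (Subrepresentation.isIrreducible_of_isAtom hN), (hρ.toRepresentation N).of_equiv f⟩, _, σ,
    (hρ.toRepresentation N').of_equiv f', ?_, ⟨?_⟩⟩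
  · refine Submodule.finrank_lt fun htop => hN.1 ?_
    have h := hN'.inf_eq_bot
    rw [htop, inf_top_eq] at h
    exact Subrepresentation.toSubmodule_injective h
  · exact (Subrepresentation.prodEquiv hN').symm.trans (f.prodCongr f')

/-- Induction on finite dimensional smooth representations: a property holds for all of them if it
holds for the zero representation and is inherited by sums with an irreducible representation. -/
theorem IsSmoothRep.induction
    {motive : ∀ {d : ℕ}, Representation (PadicAlgCl p) G (Fin d → PadicAlgCl p) → Prop}
    (zero : ∀ ρ : Representation (PadicAlgCl p) G (Fin 0 → PadicAlgCl p), motive ρ)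
    (prod : ∀ {d e : ℕ} (π : IrrRep p G)
      (σ : Representation (PadicAlgCl p) G (Fin e → PadicAlgCl p)), IsSmoothRep σ → motive σ →
      ∀ ρ : Representation (PadicAlgCl p) G (Fin d → PadicAlgCl p), ρ.Equiv (π.ρ.prod σ) →
      motive ρ) {d : ℕ} {ρ : Representation (PadicAlgCl p) G (Fin d → PadicAlgCl p)}
    (hρ : IsSmoothRep ρ) : motive ρ := by
  induction d using Nat.strong_induction_on with
  | _ d ih =>
    obtain rfl | hd := Nat.eq_zero_or_pos d
    · exact zero ρ
    · have : NeZero d := ⟨hd.ne'⟩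
      obtain ⟨π, e, σ, hσ, he, ⟨f⟩⟩ := hρ.exists_irreducible_prod
      rw [Module.finrank_fin_fun] at he
      exact prod π σ hσ (ih e he hσ) ρ f

end Smooth

/-! ### Classes of representations -/

section RepClass

variable {p : ℕ} [Fact p.Prime] {G : Type*} [Group G] [TopologicalSpace G]
  {V W : Type*} [AddCommGroup V] [Module (PadicAlgCl p) V] [AddCommGroup W]
  [Module (PadicAlgCl p) W]

theorem repClass_congr {ρ : Representation (PadicAlgCl p) G V}
    {σ : Representation (PadicAlgCl p) G W} (e : ρ.Equiv σ) : repClass ρ = repClass σ := by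
  rw [repClass, repClass]
  exact finsum_congr fun π => by rw [finrank_intertwiningMap_congr e]

theorem repClass_of_subsingleton [Subsingleton V] (ρ : Representation (PadicAlgCl p) G V) :
    repClass ρ = 0 := by
  rw [repClass]
  refine finsum_eq_zero_of_forall_eq_zero fun π => ?_
  have : Subsingleton (Representation.IntertwiningMap π.out.ρ ρ) :=
    ⟨fun f g => DFunLike.ext _ _ fun v => Subsingleton.elim _ _⟩
  rw [Module.finrank_zero_of_subsingleton, zero_smul]

/-- Schur's lemma, for the multiplicities of an irreducible representation. -/
theorem finrank_intertwiningMap_irreducible [DecidableEq (Irr p G)] (π : IrrRep p G)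
    (π' : Irr p G) : Module.finrank (PadicAlgCl p) (Representation.IntertwiningMap π'.out.ρ π.ρ) =
      if π' = Irr.mk π then 1 else 0 := by
  have := π.irreducible
  have := π'.out.irreducible
  split_ifs with h
  · have h1 : Irr.mk π'.out = Irr.mk π := by rw [Irr.mk_out, h]
    obtain ⟨e⟩ := Irr.mk_eq_mk.1 h1
    rw [← finrank_intertwiningMap_congr e]
    exact Representation.IsIrreducible.finrank_intertwiningMap_self _
  · have : IsEmpty (π'.out.ρ.Equiv π.ρ) :=
      ⟨fun e => h (by rw [← Irr.mk_out π', Irr.mk_eq_mk]; exact ⟨e⟩)⟩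
    exact Module.finrank_zero_of_subsingleton

theorem repClass_irreducible (π : IrrRep p G) :
    repClass π.ρ = FreeAbelianGroup.of (Irr.mk π) := by
  classical
  rw [repClass, finsum_eq_single _ (Irr.mk π)]
  · rw [finrank_intertwiningMap_irreducible, if_pos rfl, one_smul]
  · intro π' h
    rw [finrank_intertwiningMap_irreducible, if_neg h, zero_smul]

variable [IsTopologicalGroup G] [CompactSpace G]

/-- Only finitely many irreducible representations occur in a smooth one; the sum which defines its
class is therefore not a junk value. -/
theorem IsSmoothRep.finite_support [FiniteDimensional (PadicAlgCl p) V]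
    {ρ : Representation (PadicAlgCl p) G V} (hρ : IsSmoothRep ρ) :
    {π : Irr p G | Module.finrank (PadicAlgCl p)
      (Representation.IntertwiningMap π.out.ρ ρ) ≠ 0}.Finite := by
  classical
  obtain ⟨τ, ⟨e⟩⟩ := exists_equiv_fin ρ
  simp only [finrank_intertwiningMap_congr e]
  refine IsSmoothRep.induction (motive := fun τ => {π : Irr p G | Module.finrank (PadicAlgCl p)
      (Representation.IntertwiningMap π.out.ρ τ) ≠ 0}.Finite) (fun τ => ?_) ?_ (hρ.of_equiv e)
  · refine Set.Finite.subset Set.finite_empty fun π hπ => hπ ?_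
    have : Subsingleton (Representation.IntertwiningMap π.out.ρ τ) :=
      ⟨fun f g => DFunLike.ext _ _ fun v => Subsingleton.elim _ _⟩
    exact Module.finrank_zero_of_subsingleton
  · intro d e π σ _ ih ρ f
    refine (ih.union (Set.finite_singleton (Irr.mk π))).subset fun π' hπ' => ?_
    by_contra h
    simp only [Set.mem_union, Set.mem_ofPred_eq, Set.mem_singleton_iff, not_or, not_not] at h
    apply hπ'
    rw [finrank_intertwiningMap_congr f, finrank_intertwiningMap_prod, h.1,
      finrank_intertwiningMap_irreducible, if_neg h.2]

theorem repClass_prod [FiniteDimensional (PadicAlgCl p) V] [FiniteDimensional (PadicAlgCl p) W]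
    {ρ : Representation (PadicAlgCl p) G V} {σ : Representation (PadicAlgCl p) G W}
    (hρ : IsSmoothRep ρ) (hσ : IsSmoothRep σ) :
    repClass (ρ.prod σ) = repClass ρ + repClass σ := by
  rw [repClass, repClass, repClass, ← finsum_add_distrib]
  · exact finsum_congr fun π => by rw [finrank_intertwiningMap_prod, add_smul]
  · exact hρ.finite_support.subset fun π hπ h => hπ (by simp only [h, zero_smul])
  · exact hσ.finite_support.subset fun π hπ h => hπ (by simp only [h, zero_smul])

end RepClass

/-! ### Induced representations -/

section Induction

open scoped TensorProduct

namespace Representation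

section functoriality

variable {k G H : Type*} [CommRing k] [Group G] [Group H] (φ : G →* H) {A B : Type*}
  [AddCommGroup A] [Module k A] [AddCommGroup B] [Module k B]
  {ρ : Representation k G A} {σ : Representation k G B}

/-- The map of induced representations attached to an intertwining map. -/
noncomputable def indMap (f : IntertwiningMap ρ σ) : IntertwiningMap (ind φ ρ) (ind φ σ) where
  toLinearMap := Coinvariants.map _ _ ⟨f.toLinearMap.lTensor _, by
    simp [LinearMap.lTensor_comp_map, f.2, LinearMap.map_comp_lTensor]⟩
  isIntertwining' g := by ext; simp

/-- Induced representations are spanned by the translates of the inducing representation. -/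
theorem ind_induction {motive : IndV φ ρ → Prop} (mk : ∀ h a, motive (IndV.mk φ ρ h a))
    (add : ∀ x y, motive x → motive y → motive (x + y)) (x : IndV φ ρ) : motive x := by
  have h0 : motive 0 := by
    have h := mk 1 0
    rwa [map_zero] at h
  induction x using Coinvariants.induction_on with
  | _ x =>
  induction x with
  | zero => rw [map_zero]; exact h0
  | add x y hx hy => rw [map_add]; exact add _ _ hx hy
  | tmul x a =>
    induction x using MonoidAlgebra.induction_linear with
    | zero => rw [TensorProduct.zero_tmul, map_zero]; exact h0
    | add x y hx hy => rw [TensorProduct.add_tmul, map_add]; exact add _ _ hx hy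
    | single h r =>
      have h1 : MonoidAlgebra.single h r ⊗ₜ[k] a = MonoidAlgebra.single h (1 : k) ⊗ₜ[k] (r • a) := by
        rw [← TensorProduct.smul_tmul, MonoidAlgebra.smul_single, smul_eq_mul, mul_one]
      rw [h1]
      exact mk h (r • a)

/-- The relation which defines the induced representation. -/
theorem indV_mk_mul (g : G) (h : H) (a : A) :
    IndV.mk φ ρ (φ g * h) (ρ g a) = IndV.mk φ ρ h a :=
  (Coinvariants.mk_eq_iff _).2 (by
    have h1 := Coinvariants.sub_mem_ker (ρ := tprod (MonoidHom.comp (leftRegular k H) φ) ρ) g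
      (MonoidAlgebra.single h (1 : k) ⊗ₜ[k] a)
    simpa using h1)

/-- Induction commutes with direct sums. -/
noncomputable def indProdEquiv :
    (ind φ (ρ.prod σ)).Equiv ((ind φ ρ).prod (ind φ σ)) :=
  .mk (LinearEquiv.ofLinearMap
    ((indMap φ (IntertwiningMap.fst k ρ σ)).prod
      (indMap φ (IntertwiningMap.snd k ρ σ))).toLinearMap
    (((indMap φ (IntertwiningMap.inl k ρ σ)).toLinearMap).coprod
      (indMap φ (IntertwiningMap.inr k ρ σ)).toLinearMap)
    (by
      refine LinearMap.prod_ext (IndV.hom_ext _ _ fun h => LinearMap.ext fun a => ?_)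
        (IndV.hom_ext _ _ fun h => LinearMap.ext fun a => ?_)
      · exact Prod.ext rfl (map_zero (IndV.mk φ σ h))
      · exact Prod.ext (map_zero (IndV.mk φ ρ h)) rfl)
    (by
      refine IndV.hom_ext _ _ fun h => LinearMap.ext fun a => ?_
      change IndV.mk φ (ρ.prod σ) h (a.1, 0) + IndV.mk φ (ρ.prod σ) h (0, a.2) =
        IndV.mk φ (ρ.prod σ) h a
      rw [← map_add, Prod.mk_add_mk, add_zero, zero_add]))
    ((indMap φ (IntertwiningMap.fst k ρ σ)).prod
      (indMap φ (IntertwiningMap.snd k ρ σ))).isIntertwining'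

/-- Induction preserves isomorphisms. -/
noncomputable def indCongr (e : ρ.Equiv σ) : (ind φ ρ).Equiv (ind φ σ) :=
  .mk (LinearEquiv.ofLinearMap (indMap φ e.toIntertwiningMap).toLinearMap
    (indMap φ e.symm.toIntertwiningMap).toLinearMap
    (IndV.hom_ext _ _ fun h => LinearMap.ext fun a =>
      congrArg (IndV.mk φ σ h) (e.apply_symm_apply a))
    (IndV.hom_ext _ _ fun h => LinearMap.ext fun a =>
      congrArg (IndV.mk φ ρ h) (e.symm_apply_apply a))) (indMap φ e.toIntertwiningMap).isIntertwining'

theorem subsingleton_indV [Subsingleton A] : Subsingleton (IndV φ ρ) := by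
  have : ∀ x : IndV φ ρ, x = 0 := ind_induction φ
    (fun h a => by rw [Subsingleton.elim a 0, map_zero])
    (fun x y hx hy => by rw [hx, hy, add_zero])
  exact ⟨fun x y => (this x).trans (this y).symm⟩

end functoriality

end Representation


/-! ### The representation `V ⊗ ℚ_p[G/H]` as an induced representation -/

section TensorQuotient

/-- The space `V ⊗ ℚ_p[G/H]` is spanned by the elements `v ⊗ g H`. -/
theorem tensorQuotient_induction {p : ℕ} [Fact p.Prime] {G : Type*} [Group G] {V : Type*}
    [AddCommGroup V] [Module ℚ_[p] V] {H : Subgroup G}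
    {motive : V ⊗[ℚ_[p]] MonoidAlgebra ℚ_[p] (G ⧸ H) → Prop}
    (tmul : ∀ v (g : G), motive (v ⊗ₜ MonoidAlgebra.single (g : G ⧸ H) 1))
    (add : ∀ x y, motive x → motive y → motive (x + y))
    (x : V ⊗[ℚ_[p]] MonoidAlgebra ℚ_[p] (G ⧸ H)) : motive x := by
  have h0 : motive 0 := by
    have h := tmul 0 1
    rwa [TensorProduct.zero_tmul] at h
  induction x with
  | zero => exact h0
  | add x y hx hy => exact add _ _ hx hy
  | tmul v a =>
    induction a using MonoidAlgebra.induction_linear with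
    | zero => rw [TensorProduct.tmul_zero]; exact h0
    | add x y hx hy => rw [TensorProduct.tmul_add]; exact add _ _ hx hy
    | single x r =>
      obtain ⟨g, rfl⟩ := QuotientGroup.mk_surjective x
      have h1 : v ⊗ₜ[ℚ_[p]] MonoidAlgebra.single (g : G ⧸ H) r =
          (r • v) ⊗ₜ[ℚ_[p]] MonoidAlgebra.single (g : G ⧸ H) (1 : ℚ_[p]) := by
        rw [TensorProduct.smul_tmul, MonoidAlgebra.smul_single, smul_eq_mul, mul_one]
      rw [h1]
      exact tmul _ g

variable {p : ℕ} [Fact p.Prime] {G : Type*} [Group G] {V : Type*} [AddCommGroup V]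
  [Module (PadicAlgCl p) V] [Module ℚ_[p] V] [IsScalarTower ℚ_[p] (PadicAlgCl p) V]

theorem tensorQuotient_tmul_single (H : Subgroup G) (ρ : Representation (PadicAlgCl p) G V)
    (g : G) (v : V) (x : G ⧸ H) (r : ℚ_[p]) :
    tensorQuotient H ρ g (v ⊗ₜ MonoidAlgebra.single x r) =
      ρ g v ⊗ₜ MonoidAlgebra.single (g • x) r := by
  change ρ g v ⊗ₜ Representation.ofMulAction ℚ_[p] G (G ⧸ H) g (MonoidAlgebra.single x r) = _
  rw [Representation.ofMulAction_single]

open Classical in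
/-- The space `V ⊗ ℚ_p[G/H]` as a direct sum of copies of `V` indexed by `G/H`. -/
noncomputable def tensorQuotientFinsupp (p : ℕ) [Fact p.Prime] (H : Subgroup G) (V : Type*)
    [AddCommGroup V] [Module (PadicAlgCl p) V] [Module ℚ_[p] V]
    [IsScalarTower ℚ_[p] (PadicAlgCl p) V] :
    (V ⊗[ℚ_[p]] MonoidAlgebra ℚ_[p] (G ⧸ H)) ≃ₗ[PadicAlgCl p] (G ⧸ H →₀ V) :=
  (TensorProduct.AlgebraTensorModule.congr (LinearEquiv.refl (PadicAlgCl p) V)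
    (MonoidAlgebra.coeffLinearEquiv ℚ_[p])).trans
    (TensorProduct.finsuppScalarRight ℚ_[p] (PadicAlgCl p) V (G ⧸ H))

open Classical in
theorem tensorQuotientFinsupp_tmul_single (H : Subgroup G) (v : V) (x : G ⧸ H) :
    tensorQuotientFinsupp p H V (v ⊗ₜ MonoidAlgebra.single x 1) = Finsupp.single x v := by
  change TensorProduct.finsuppScalarRight ℚ_[p] (PadicAlgCl p) V (G ⧸ H)
    (v ⊗ₜ Finsupp.single x 1) = _
  rw [TensorProduct.finsuppScalarRight_apply_tmul]
  simp

instance (H : Subgroup G) [Finite (G ⧸ H)] [FiniteDimensional (PadicAlgCl p) V] :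
    FiniteDimensional (PadicAlgCl p) (V ⊗[ℚ_[p]] MonoidAlgebra ℚ_[p] (G ⧸ H)) :=
  (tensorQuotientFinsupp p H V).symm.finiteDimensional

open Representation in
/-- The map `h ⊗ v ↦ h⁻¹ v ⊗ h⁻¹ H` from the representation induced from the restriction of `V`
to `V ⊗ ℚ_p[G/H]`. -/
noncomputable def indResToTensor (H : Subgroup G) (ρ : Representation (PadicAlgCl p) G V) :
    IndV H.subtype (ρ.comp H.subtype) →ₗ[PadicAlgCl p]
      V ⊗[ℚ_[p]] MonoidAlgebra ℚ_[p] (G ⧸ H) :=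
  Coinvariants.lift _
    (TensorProduct.lift <| (Finsupp.lift _ _ _ fun h =>
      (tensorQuotientFinsupp p H V).symm.toLinearMap ∘ₗ
        Finsupp.lsingle ((h⁻¹ : G) : G ⧸ H) ∘ₗ ρ h⁻¹) ∘ₗ
      (MonoidAlgebra.coeffLinearEquiv (PadicAlgCl p)).toLinearMap)
    fun g => by
      ext h v
      have h1 : (((h⁻¹ * (g : G)⁻¹ : G)) : G ⧸ H) = ((h⁻¹ : G) : G ⧸ H) := by
        rw [QuotientGroup.eq]
        simp
      simp [Representation.ofMulAction_single, h1]

open Representation in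
theorem indResToTensor_mk (H : Subgroup G) (ρ : Representation (PadicAlgCl p) G V) (h : G)
    (v : V) : indResToTensor H ρ (IndV.mk H.subtype (ρ.comp H.subtype) h v) =
      ρ h⁻¹ v ⊗ₜ MonoidAlgebra.single ((h⁻¹ : G) : G ⧸ H) 1 := by
  rw [← (tensorQuotientFinsupp p H V).injective.eq_iff, tensorQuotientFinsupp_tmul_single]
  simp [indResToTensor]

open Representation in
/-- The inverse of `indResToTensor`, given by a choice of coset representatives. -/
noncomputable def tensorToIndRes (H : Subgroup G) (ρ : Representation (PadicAlgCl p) G V) :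
    (V ⊗[ℚ_[p]] MonoidAlgebra ℚ_[p] (G ⧸ H)) →ₗ[PadicAlgCl p]
      IndV H.subtype (ρ.comp H.subtype) :=
  (Finsupp.lsum (PadicAlgCl p) fun x : G ⧸ H =>
    IndV.mk H.subtype (ρ.comp H.subtype) x.out⁻¹ ∘ₗ ρ x.out⁻¹) ∘ₗ
    (tensorQuotientFinsupp p H V).toLinearMap

open Representation in
theorem tensorToIndRes_tmul (H : Subgroup G) (ρ : Representation (PadicAlgCl p) G V) (g : G)
    (v : V) : tensorToIndRes H ρ (v ⊗ₜ MonoidAlgebra.single (g : G ⧸ H) 1) =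
      IndV.mk H.subtype (ρ.comp H.subtype) g⁻¹ (ρ g⁻¹ v) := by
  have h0 : tensorToIndRes H ρ (v ⊗ₜ MonoidAlgebra.single (g : G ⧸ H) 1) =
      IndV.mk H.subtype (ρ.comp H.subtype) (g : G ⧸ H).out⁻¹ (ρ (g : G ⧸ H).out⁻¹ v) := by
    change Finsupp.lsum (PadicAlgCl p) _ (tensorQuotientFinsupp p H V _) = _
    rw [tensorQuotientFinsupp_tmul_single, Finsupp.lsum_single]
    rfl
  rw [h0]
  obtain ⟨h, hh⟩ := QuotientGroup.mk_out_eq_mul H g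
  have h1 : g⁻¹ = H.subtype h * (g : G ⧸ H).out⁻¹ := by
    rw [hh, Subgroup.subtype_apply, mul_inv_rev, mul_inv_cancel_left]
  rw [h1, map_mul ρ, Module.End.mul_apply]
  exact (indV_mk_mul H.subtype h _ _).symm

open Representation in
/-- The representation `V ⊗ ℚ_p[G/H]` is induced from the restriction of `V` to `H`. -/
noncomputable def indResEquivTensor (H : Subgroup G) (ρ : Representation (PadicAlgCl p) G V) :
    (ind H.subtype (ρ.comp H.subtype)).Equiv (tensorQuotient H ρ) :=
  .mk (LinearEquiv.ofLinearMap (indResToTensor H ρ) (tensorToIndRes H ρ)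
    (LinearMap.ext fun x => by
      induction x using tensorQuotient_induction with
      | tmul v g =>
        rw [LinearMap.comp_apply, tensorToIndRes_tmul, indResToTensor_mk, inv_inv,
          ← Module.End.mul_apply, ← map_mul, mul_inv_cancel, map_one]
        rfl
      | add x y hx hy => rw [map_add, hx, hy, map_add])
    (IndV.hom_ext _ _ fun h => LinearMap.ext fun v => by
      rw [LinearMap.comp_apply, LinearMap.comp_apply, indResToTensor_mk, tensorToIndRes_tmul,
        inv_inv, ← Module.End.mul_apply, ← map_mul, mul_inv_cancel, map_one]
      rfl)) fun g => IndV.hom_ext _ _ fun h => LinearMap.ext fun v => by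
    change indResToTensor H ρ (ind _ _ g (IndV.mk _ _ h v)) =
      tensorQuotient H ρ g (indResToTensor H ρ (IndV.mk _ _ h v))
    rw [ind_mk, indResToTensor_mk, indResToTensor_mk, tensorQuotient_tmul_single, mul_inv_rev,
      inv_inv, map_mul]
    rfl

end TensorQuotient

/-! ### Restriction and induction of classes -/

section Smooth

variable {p : ℕ} [Fact p.Prime] {G : Type*} [Group G] [TopologicalSpace G]
  [IsTopologicalGroup G] [CompactSpace G] {H : Subgroup G}

open Representation in
/-- An induced representation is a sum of translates of the inducing one, indexed by the finitely
many cosets. -/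
theorem finiteDimensional_indV {V : Type*} [AddCommGroup V] [Module (PadicAlgCl p) V]
    [FiniteDimensional (PadicAlgCl p) V] (hH : IsOpen (H : Set G))
    (σ : Representation (PadicAlgCl p) H V) :
    FiniteDimensional (PadicAlgCl p) (IndV H.subtype σ) := by
  have : Finite (G ⧸ H) := Subgroup.quotient_finite_of_isOpen _ hH
  have := Fintype.ofFinite (G ⧸ H)
  let F : (G ⧸ H → V) →ₗ[PadicAlgCl p] IndV H.subtype σ :=
    ∑ x : G ⧸ H, IndV.mk H.subtype σ x.out⁻¹ ∘ₗ LinearMap.proj x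
  refine Module.Finite.of_surjective F fun y => ?_
  induction y using ind_induction with
  | mk g v =>
    classical
    obtain ⟨h, hh⟩ := QuotientGroup.mk_out_eq_mul H g⁻¹
    refine ⟨Pi.single ((g⁻¹ : G) : G ⧸ H) (σ h⁻¹ v), ?_⟩
    have h1 : ((g⁻¹ : G) : G ⧸ H).out⁻¹ = H.subtype h⁻¹ * g := by
      rw [hh, mul_inv_rev, inv_inv]
      rfl
    rw [LinearMap.sum_apply, Finset.sum_eq_single ((g⁻¹ : G) : G ⧸ H)]
    · rw [LinearMap.comp_apply, LinearMap.proj_apply, Pi.single_eq_same, h1]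
      exact indV_mk_mul H.subtype h⁻¹ g v
    · intro x _ hx
      rw [LinearMap.comp_apply, LinearMap.proj_apply, Pi.single_eq_of_ne hx, map_zero]
    · simp
  | add x y hx hy =>
    obtain ⟨a, rfl⟩ := hx
    obtain ⟨b, rfl⟩ := hy
    exact ⟨a + b, map_add _ _ _⟩

open Representation in
/-- An induced representation is trivial on every normal subgroup of `G` which is contained in the
kernel of the inducing one. -/
theorem IsSmoothRep.ind {V : Type*} [AddCommGroup V] [Module (PadicAlgCl p) V]
    (hH : IsOpen (H : Set G)) {σ : Representation (PadicAlgCl p) H V} (hσ : IsSmoothRep σ) :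
    IsSmoothRep (Representation.ind H.subtype σ) := by
  let U := LambdaInf.core hH (LambdaInf.repKernel σ hσ)
  refine ⟨U.toOpenSubgroup, fun u hu => IndV.hom_ext _ _ fun h => LinearMap.ext fun v => ?_⟩
  change Representation.ind H.subtype σ u (IndV.mk _ _ h v) = IndV.mk _ _ h v
  -- the translate of `h` by `u⁻¹` is its translate on the other side by a conjugate of `u⁻¹`
  have hu' : h * u⁻¹ * h⁻¹ ∈ U.toSubgroup := U.isNormal'.conj_mem _ (U.inv_mem hu) h
  have hmem : h * u⁻¹ * h⁻¹ ∈ H := LambdaInf.core_le_subgroup hH _ hu'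
  have h1 : σ ⟨_, hmem⟩ = 1 := LambdaInf.core_le hH (LambdaInf.repKernel σ hσ) hu'
  have h2 := indV_mk_mul H.subtype (ρ := σ) ⟨_, hmem⟩ h v
  rw [h1, Subgroup.subtype_apply, inv_mul_cancel_right] at h2
  rw [ind_mk]
  exact h2

theorem IsSmoothRep.tensorQuotient {V : Type*} [AddCommGroup V] [Module (PadicAlgCl p) V]
    [Module ℚ_[p] V] [IsScalarTower ℚ_[p] (PadicAlgCl p) V] (hH : IsOpen (H : Set G))
    {ρ : Representation (PadicAlgCl p) G V} (hρ : IsSmoothRep ρ) :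
    IsSmoothRep (tensorQuotient H ρ) := by
  refine .of_equiv (indResEquivTensor H ρ) (.ind hH ?_)
  obtain ⟨U, hU⟩ := hρ
  exact ⟨U.comap H.subtype continuous_subtype_val, fun g hg => hU g hg⟩

/-- Induction of classes is given by induction of representations, also for reducible ones. -/
theorem indRep_repClass (hH : IsOpen (H : Set G)) {d : ℕ}
    {σ : Representation (PadicAlgCl p) H (Fin d → PadicAlgCl p)} (hσ : IsSmoothRep σ) :
    indRep p H (repClass σ) = repClass (Representation.ind H.subtype σ) := by
  have : CompactSpace H := isCompact_iff_compactSpace.1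
    (Subgroup.isClosed_of_isOpen _ hH).isCompact
  refine IsSmoothRep.induction (motive := fun σ =>
    indRep p H (repClass σ) = repClass (Representation.ind H.subtype σ)) (fun σ => ?_) ?_ hσ
  · have := Representation.subsingleton_indV H.subtype (ρ := σ)
    rw [repClass_of_subsingleton, repClass_of_subsingleton, map_zero]
  · intro d e π σ hσ ih ρ f
    have := finiteDimensional_indV hH σ
    have := finiteDimensional_indV hH π.ρ
    obtain ⟨f'⟩ := Irr.mk_eq_mk.1 (Irr.mk_out (Irr.mk π))
    rw [repClass_congr f, repClass_prod π.smooth hσ, map_add, ih, repClass_irreducible,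
      repClass_congr (Representation.indCongr H.subtype f),
      repClass_congr (Representation.indProdEquiv H.subtype),
      repClass_prod (π.smooth.ind hH) (hσ.ind hH), indRep, FreeAbelianGroup.lift_apply_of,
      repClass_congr (Representation.indCongr H.subtype f')]

/-- The operator `ι` is restriction followed by induction. -/
theorem iota_eq_indRep_comp_resRep (hH : IsOpen (H : Set G)) :
    iota p H = (indRep p H).comp (resRep p H) := by
  ext π
  have hsmooth : IsSmoothRep (π.out.ρ.comp H.subtype) := by
    obtain ⟨U, hU⟩ := π.out.smooth
    exact ⟨U.comap H.subtype continuous_subtype_val, fun g hg => hU g hg⟩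
  rw [AddMonoidHom.comp_apply, iota, resRep, FreeAbelianGroup.lift_apply_of,
    FreeAbelianGroup.lift_apply_of, indRep_repClass hH hsmooth]
  exact (repClass_congr (indResEquivTensor H π.out.ρ)).symm

end Smooth

end Induction

/-! ### Determinants on `K₁` as determinants of linear maps -/

namespace K1

open K1Theory

variable {R A B K : Type*} [Ring R] [Ring A] [Ring B] [Field K] {V W U : Type*} [AddCommGroup V]
  [Module K V] [AddCommGroup W] [Module K W] [AddCommGroup U] [Module K U]

/-- The action of an `n × n` matrix over `R` on `V ^ n`, given an action of `R` on `V`. -/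
noncomputable def blockEnd (φ : R →+* Module.End K V) (n : ℕ) :
    Matrix (Fin n) (Fin n) R →+* Module.End K (Fin n → V) :=
  (endVecRingEquivMatrixEnd (Fin n) K V).symm.toRingHom.comp φ.mapMatrix

theorem blockEnd_apply (φ : R →+* Module.End K V) (n : ℕ) (M : Matrix (Fin n) (Fin n) R)
    (w : Fin n → V) (i : Fin n) : blockEnd φ n M w i = ∑ j, φ (M i j) (w j) := rfl

/-- Isomorphic modules over `R` give the same determinants. -/
theorem det_blockEnd_congr {φ : R →+* Module.End K V} {ψ : R →+* Module.End K W} (e : V ≃ₗ[K] W)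
    (he : ∀ a v, e (φ a v) = ψ a (e v)) (n : ℕ) (M : Matrix (Fin n) (Fin n) R) :
    LinearMap.det (blockEnd φ n M) = LinearMap.det (blockEnd ψ n M) := by
  let E : (Fin n → V) ≃ₗ[K] (Fin n → W) := LinearEquiv.piCongrRight fun _ => e
  rw [← LinearMap.det_conj (blockEnd φ n M) E]
  congr 1
  refine LinearMap.ext fun w => funext fun i => ?_
  change e (blockEnd φ n M (fun j => e.symm (w j)) i) = _
  rw [blockEnd_apply, blockEnd_apply, map_sum]
  exact Finset.sum_congr rfl fun j _ => by rw [he, LinearEquiv.apply_symm_apply]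

/-- Determinants are multiplicative on direct sums of modules over `R`. -/
theorem det_blockEnd_prod [FiniteDimensional K V] [FiniteDimensional K W]
    {φ : R →+* Module.End K V} {ψ : R →+* Module.End K W} {χ : R →+* Module.End K U}
    (e : U ≃ₗ[K] V × W) (he : ∀ a u, e (χ a u) = (φ a (e u).1, ψ a (e u).2)) (n : ℕ)
    (M : Matrix (Fin n) (Fin n) R) : LinearMap.det (blockEnd χ n M) =
      LinearMap.det (blockEnd φ n M) * LinearMap.det (blockEnd ψ n M) := by
  let E : (Fin n → U) ≃ₗ[K] (Fin n → V) × (Fin n → W) :=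
    { toFun := fun w => (fun i => (e (w i)).1, fun i => (e (w i)).2)
      invFun := fun x i => e.symm (x.1 i, x.2 i)
      map_add' := fun w w' => by simp only [Pi.add_apply, map_add]; rfl
      map_smul' := fun c w => by simp only [Pi.smul_apply, map_smul]; rfl
      left_inv := fun w => by simp
      right_inv := fun x => by simp }
  rw [← LinearMap.det_prodMap, ← LinearMap.det_conj (blockEnd χ n M) E]
  congr 1
  refine LinearMap.ext fun x => ?_
  have h1 : ∀ i, e (blockEnd χ n M (E.symm x) i) =
      (blockEnd φ n M x.1 i, blockEnd ψ n M x.2 i) := by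
    intro i
    have h2 : ∀ j, e (E.symm x j) = (x.1 j, x.2 j) := fun j => e.apply_symm_apply _
    rw [blockEnd_apply, blockEnd_apply, blockEnd_apply, map_sum]
    simp only [he, h2]
    exact Prod.ext (by rw [Prod.fst_sum]) (by rw [Prod.snd_sum])
  exact Prod.ext (funext fun i => congrArg Prod.fst (h1 i))
    (funext fun i => congrArg Prod.snd (h1 i))

/-- The determinant of a class in `K₁`, as the determinant of a linear map. -/
theorem detHom_of_eq_det {d : ℕ} (φ : R →+* Module.End K (Fin d → K)) (n : ℕ) (g : GLn n R) :
    (detHom ((LinearMap.toMatrixAlgEquiv' (R := K) (n := Fin d)).toRingEquiv.toRingHom.comp φ)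
      (of R n g) : K) = LinearMap.det (blockEnd φ n g.1) := by
  rw [detHom_of, ← LinearMap.det_toLin',
    ← LinearMap.det_conj (blockEnd φ n g.1) (LinearEquiv.curry K K (Fin n) (Fin d)).symm]
  congr 1
  refine LinearMap.ext fun w => funext fun ⟨i, k⟩ => ?_
  change ∑ x : Fin n × Fin d, LinearMap.toMatrix' (φ (g.1 i x.1)) k x.2 * w x =
    (blockEnd φ n g.1 (fun j l => w (j, l)) i) k
  rw [blockEnd_apply, Fintype.sum_prod_type, Finset.sum_apply]
  refine Finset.sum_congr rfl fun j _ => ?_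
  exact congrFun (LinearMap.toMatrix'_mulVec (φ (g.1 i j)) fun l => w (j, l)) k

/-! ### The transfer in an arbitrary basis -/

section transfer

variable {f : B →+* A} {m m' : ℕ} {b : Fin m → A} {b' : Fin m' → A}

/-- The map `(v i) ↦ ∑ i, b i v i`, for a family `b` of elements of `A`. It identifies `A ⊗_B V`
with `V ^ m`, if `b` is a basis and `A ⊗_B V` is represented by `ι : V → U`. -/
noncomputable def basisMap (ψ : A →+* Module.End K U) (ι : V →ₗ[K] U) (b : Fin m → A) :
    (Fin m → V) →ₗ[K] U :=
  ∑ i, ψ (b i) ∘ₗ ι ∘ₗ LinearMap.proj i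

theorem basisMap_apply (ψ : A →+* Module.End K U) (ι : V →ₗ[K] U) (b : Fin m → A)
    (w : Fin m → V) : basisMap ψ ι b w = ∑ i, ψ (b i) (ι (w i)) := by
  rw [basisMap, LinearMap.sum_apply]
  rfl

variable {φ : B →+* Module.End K V} {ψ : A →+* Module.End K U} {ι : V →ₗ[K] U}

/-- A change of the family `b` by a matrix `C` over `B` amounts to an action of `C` on vectors. -/
theorem basisMap_sum_mul (hι : ∀ c v, ι (φ c v) = ψ (f c) (ι v)) (C : Fin m → Fin m' → B)
    (w : Fin m' → V) :
    basisMap ψ ι (fun j => ∑ i, b i * f (C i j)) w =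
      basisMap ψ ι b (fun i => ∑ j, φ (C i j) (w j)) := by
  rw [basisMap_apply, basisMap_apply]
  simp only [map_sum, map_mul, LinearMap.sum_apply, Module.End.mul_apply, hι]
  exact Finset.sum_comm

/-- If one basis identifies `U` with `A ⊗_B V`, then any other basis does. Both bases give
coordinates, and the matrices of the coordinate changes are inverse to each other. -/
theorem IsRightBasis.bijective_basisMap (hb : IsRightBasis f b) (hb' : IsRightBasis f b')
    (hι : ∀ c v, ι (φ c v) = ψ (f c) (ι v))
    (hbij : Function.Bijective (basisMap ψ ι b')) : Function.Bijective (basisMap ψ ι b) := by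
  -- the product of the two matrices of coordinate changes, which may be rectangular
  have key : ∀ {k l : ℕ} {a : Fin k → A} {a' : Fin l → A} (ha : IsRightBasis f a)
      (ha' : IsRightBasis f a') (i j : Fin k),
      ∑ s, ha.coord (a' s) i * ha'.coord (a j) s = (Pi.single j 1 : Fin k → B) i := by
    intro k l a a' ha ha' i j
    have h1 : ha.coord (a j) = Pi.single j 1 := ha.coord_eq (by
      rw [Finset.sum_eq_single j] <;> simp +contextual)
    have h2 : ha.coord (a j) = fun i => ∑ s, ha.coord (a' s) i * ha'.coord (a j) s :=
      ha.coord_eq (by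
        simp only [map_sum, map_mul, Finset.mul_sum]
        rw [Finset.sum_comm]
        simp only [← mul_assoc, ← Finset.sum_mul, ha.sum_coord, ha'.sum_coord])
    rw [← h1, h2]
  have hC : ∀ w, basisMap ψ ι b w =
      basisMap ψ ι b' (fun i => ∑ j, φ (hb'.coord (b j) i) (w j)) := by
    intro w
    rw [← basisMap_sum_mul hι]
    simp only [hb'.sum_coord]
  have inv : ∀ {k l : ℕ} {a : Fin k → A} {a' : Fin l → A} (ha : IsRightBasis f a)
      (ha' : IsRightBasis f a') (w : Fin k → V),
      (fun i => ∑ s, φ (ha.coord (a' s) i) (∑ j, φ (ha'.coord (a j) s) (w j))) = w := by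
    intro k l a a' ha ha' w
    funext i
    simp only [map_sum]
    rw [Finset.sum_comm]
    simp only [← Module.End.mul_apply, ← map_mul, ← LinearMap.sum_apply, ← map_sum, key ha ha']
    rw [Finset.sum_eq_single i]
    · simp
    · intro j _ hj
      rw [Pi.single_eq_of_ne hj.symm, map_zero, LinearMap.zero_apply]
    · simp
  constructor
  · intro w w' h
    rw [hC, hC] at h
    have h1 := hbij.1 h
    rw [← inv hb hb' w, ← inv hb hb' w']
    funext i
    exact Finset.sum_congr rfl fun s _ => congrArg _ (congrFun h1 s)
  · intro u
    obtain ⟨w, rfl⟩ := hbij.2 u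
    refine ⟨fun i => ∑ s, φ (hb.coord (b' s) i) (w s), ?_⟩
    rw [hC, inv hb' hb w]

/-- The map attached to a basis commutes with the actions of `A`. -/
theorem IsRightBasis.basisMap_leftMulMatrix (hb : IsRightBasis f b)
    (hι : ∀ c v, ι (φ c v) = ψ (f c) (ι v)) (a : A) (w : Fin m → V) :
    basisMap ψ ι b (blockEnd φ m (hb.leftMulMatrix a) w) = ψ a (basisMap ψ ι b w) := by
  have h1 : ∀ j, ∑ i, b i * f (hb.leftMulMatrix a i j) = a * b j := fun j =>
    hb.sum_coord (a * b j)
  have h2 := basisMap_sum_mul (b := b) hι (fun i j => hb.leftMulMatrix a i j) w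
  simp only [h1] at h2
  rw [show blockEnd φ m (hb.leftMulMatrix a) w =
    fun i => ∑ j, φ (hb.leftMulMatrix a i j) (w j) from rfl, ← h2, basisMap_apply, basisMap_apply,
    map_sum]
  simp only [map_mul, Module.End.mul_apply]

/-- The block matrix over `B` of a matrix over `A` acts on `V ^ (n m) = (V ^ m) ^ n`. -/
theorem IsRightBasis.det_blockEnd_blockMatrix (hb : IsRightBasis f b) (n : ℕ)
    (M : Matrix (Fin n) (Fin n) A) : LinearMap.det (blockEnd φ (n * m) (hb.blockMatrix n M)) =
      LinearMap.det (blockEnd ((blockEnd φ m).comp hb.leftMulMatrix) n M) := by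
  let E : (Fin (n * m) → V) ≃ₗ[K] (Fin n → Fin m → V) :=
    (LinearEquiv.funCongrLeft K V finProdFinEquiv).trans (LinearEquiv.curry K V (Fin n) (Fin m))
  rw [← LinearMap.det_conj (blockEnd φ (n * m) (hb.blockMatrix n M)) E]
  congr 1
  refine LinearMap.ext fun w => funext fun i => funext fun k => ?_
  change blockEnd φ (n * m) (hb.blockMatrix n M) (E.symm w) (finProdFinEquiv (i, k)) = _
  rw [blockEnd_apply, blockEnd_apply, ← finProdFinEquiv.sum_comp, Fintype.sum_prod_type,
    Finset.sum_apply]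
  refine Finset.sum_congr rfl fun j _ => ?_
  rw [RingHom.comp_apply, blockEnd_apply]
  refine Finset.sum_congr rfl fun l _ => ?_
  have h1 : E.symm w (finProdFinEquiv (j, l)) = w j l :=
    congrFun (congrFun (E.apply_symm_apply w) j) l
  have h2 : hb.blockMatrix n M (finProdFinEquiv (i, k)) (finProdFinEquiv (j, l)) =
      hb.leftMulMatrix (M i j) k l := by
    change hb.leftMulMatrix
      (M (finProdFinEquiv.symm (finProdFinEquiv (i, k))).1
        (finProdFinEquiv.symm (finProdFinEquiv (j, l))).1)
      (finProdFinEquiv.symm (finProdFinEquiv (i, k))).2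
      (finProdFinEquiv.symm (finProdFinEquiv (j, l))).2 = _
    rw [Equiv.symm_apply_apply, Equiv.symm_apply_apply]
  rw [h1, h2]

/-- The determinant of the transfer on `V` is the determinant on `U = A ⊗_B V`; it suffices to
recognize `U` by means of one basis `b'`, whatever basis `b` defines the transfer. -/
theorem IsRightBasis.det_blockEnd_transfer (hb : IsRightBasis f b) (hb' : IsRightBasis f b')
    (hι : ∀ c v, ι (φ c v) = ψ (f c) (ι v)) (hbij : Function.Bijective (basisMap ψ ι b'))
    (n : ℕ) (M : Matrix (Fin n) (Fin n) A) :
    LinearMap.det (blockEnd φ (n * m) (hb.blockMatrix n M)) =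
      LinearMap.det (blockEnd ψ n M) := by
  rw [hb.det_blockEnd_blockMatrix]
  exact det_blockEnd_congr (LinearEquiv.ofBijective _ (hb.bijective_basisMap hb' hι hbij))
    (fun a w => hb.basisMap_leftMulMatrix hι a w) n M

end transfer

end K1

/-! ### The Hom-description of the norm -/

section HomDescriptionNorm

open scoped TensorProduct

variable {p : ℕ} [Fact p.Prime] {G : Type*} [Group G] [TopologicalSpace G]
  [IsTopologicalGroup G] {V W : Type*} [AddCommGroup V] [Module (PadicAlgCl p) V]
  [AddCommGroup W] [Module (PadicAlgCl p) W]

/-- A linear map which is equivariant for a subgroup `H` is equivariant for `Λ^∞(H)`. -/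
theorem LambdaInf.map_act_can {H : Subgroup G} {ρ : Representation (PadicAlgCl p) G V}
    {τ : Representation (PadicAlgCl p) G W} (hρ : IsSmoothRep ρ) (hτ : IsSmoothRep τ)
    (f : V →ₗ[PadicAlgCl p] W) (hf : ∀ h ∈ H, ∀ v, f (ρ h v) = τ h (f v)) (c : LambdaInf p H)
    (v : V) : f (act ρ hρ (can p H c) v) = act τ hτ (can p H c) (f v) := by
  let U := repKernel ρ hρ ⊓ repKernel τ hτ
  have h1 : ∀ g ∈ U, ρ g = 1 := fun g hg => rep_eq_one ρ hρ g hg.1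
  have h2 : ∀ g ∈ U, τ g = 1 := fun g hg => rep_eq_one τ hτ g hg.2
  rw [act_apply ρ hρ U h1, act_apply τ hτ U h2, can_apply]
  refine addHom_ext
    (f := (f.toAddMonoidHom.comp (LinearMap.applyₗ (R := PadicAlgCl p) v).toAddMonoidHom).comp
      ((actQuot ρ U h1).comp (quotMap p H.subtype (restrict_map H U))).toAddMonoidHom)
    (g := (LinearMap.applyₗ (R := PadicAlgCl p) (f v)).toAddMonoidHom.comp
      ((actQuot τ U h2).comp (quotMap p H.subtype (restrict_map H U))).toAddMonoidHom)
    (fun g r => ?_) (c.1 (restrict H U))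
  change f (actQuot ρ U h1 (quotMap p _ _ _) v) = actQuot τ U h2 (quotMap p _ _ _) (f v)
  rw [quotMap_single, actQuot_single, actQuot_single, map_smul]
  exact congrArg _ (hf g.1 g.2 v)

theorem LambdaInf.act_prod {ρ : Representation (PadicAlgCl p) G V}
    {σ : Representation (PadicAlgCl p) G W} (hρ : IsSmoothRep ρ) (hσ : IsSmoothRep σ)
    (hρσ : IsSmoothRep (ρ.prod σ)) (a : LambdaInf p G) (v : V × W) :
    act (ρ.prod σ) hρσ a v = (act ρ hρ a v.1, act σ hσ a v.2) := by
  let U := repKernel (ρ.prod σ) hρσ ⊓ (repKernel ρ hρ ⊓ repKernel σ hσ)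
  have h0 : ∀ g ∈ U, ρ.prod σ g = 1 := fun g hg => rep_eq_one _ hρσ g hg.1
  have h1 : ∀ g ∈ U, ρ g = 1 := fun g hg => rep_eq_one ρ hρ g hg.2.1
  have h2 : ∀ g ∈ U, σ g = 1 := fun g hg => rep_eq_one σ hσ g hg.2.2
  rw [act_apply _ hρσ U h0, act_apply ρ hρ U h1, act_apply σ hσ U h2]
  refine addHom_ext
    (f := (LinearMap.applyₗ (R := PadicAlgCl p) v).toAddMonoidHom.comp
      (actQuot (ρ.prod σ) U h0).toAddMonoidHom)
    (g := ((LinearMap.applyₗ (R := PadicAlgCl p) v.1).toAddMonoidHom.comp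
      (actQuot ρ U h1).toAddMonoidHom).prod
      ((LinearMap.applyₗ (R := PadicAlgCl p) v.2).toAddMonoidHom.comp
      (actQuot σ U h2).toAddMonoidHom)) (fun g r => ?_) (a.1 U)
  change actQuot (ρ.prod σ) U h0 _ v = (actQuot ρ U h1 _ v.1, actQuot σ U h2 _ v.2)
  rw [actQuot_single, actQuot_single, actQuot_single]
  rfl

theorem LambdaInf.act_ofGroup (ρ : Representation (PadicAlgCl p) G V) (hρ : IsSmoothRep ρ)
    (g : G) : act ρ hρ (ofGroup p g) = ρ g := by
  refine LinearMap.ext fun v => ?_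
  change actQuot ρ (repKernel ρ hρ) (rep_eq_one ρ hρ) (MonoidAlgebra.single _ 1) v = _
  rw [actQuot_single, map_one, one_smul]

theorem det_blockEnd_act_congr {ρ : Representation (PadicAlgCl p) G V}
    {σ : Representation (PadicAlgCl p) G W} (e : ρ.Equiv σ) (hρ : IsSmoothRep ρ)
    (hσ : IsSmoothRep σ) (n : ℕ) (M : Matrix (Fin n) (Fin n) (LambdaInf p G)) :
    LinearMap.det (K1.blockEnd (LambdaInf.act ρ hρ) n M) =
      LinearMap.det (K1.blockEnd (LambdaInf.act σ hσ) n M) :=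
  K1.det_blockEnd_congr e.toLinearEquiv
    (fun a v => (TwistEquiv.ofEquiv e).act_eq hρ hσ a v) n M

theorem detRep_irreducible (π : IrrRep p G) (n : ℕ) (g : K1Theory.GLn n (LambdaInf p G)) :
    (detRep (K1.of _ n g) (.ofAdd (FreeAbelianGroup.of (Irr.mk π))) : PadicAlgCl p) =
      LinearMap.det (K1.blockEnd (LambdaInf.act π.ρ π.smooth) n g.1) := by
  obtain ⟨e⟩ := Irr.mk_eq_mk.1 (Irr.mk_out (Irr.mk π))
  rw [detRep_of, LambdaInf.det, K1.detHom_of_eq_det]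
  exact det_blockEnd_act_congr e _ _ n g.1

/-- The elements `v ⊗ g H`, for `g` in a set of representatives of the cosets, form copies of `V`
whose direct sum is `V ⊗ ℚ_p[G/H]`. -/
theorem bijective_basisMap_ofGroup [Module ℚ_[p] V] [IsScalarTower ℚ_[p] (PadicAlgCl p) V]
    {H : Subgroup G} (ρ : Representation (PadicAlgCl p) G V)
    (hτ : IsSmoothRep (tensorQuotient H ρ)) {m : ℕ} (e : G ⧸ H ≃ Fin m)
    (ι : V →ₗ[PadicAlgCl p] V ⊗[ℚ_[p]] MonoidAlgebra ℚ_[p] (G ⧸ H))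
    (hι : ∀ v, ι v = v ⊗ₜ MonoidAlgebra.single ((1 : G) : G ⧸ H) 1) :
    Function.Bijective (K1.basisMap (LambdaInf.act (tensorQuotient H ρ) hτ) ι
      fun i => LambdaInf.ofGroup p (e.symm i).out) := by
  classical
  let r : Fin m → G := fun i => (e.symm i).out
  have h1 : ∀ w x, tensorQuotientFinsupp p H V (K1.basisMap
      (LambdaInf.act (tensorQuotient H ρ) hτ) ι (fun i => LambdaInf.ofGroup p (r i)) w) x =
      ρ (r (e x)) (w (e x)) := by
    intro w x
    have h2 : ∀ i, r i • ((1 : G) : G ⧸ H) = e.symm i := fun i => by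
      rw [MulAction.Quotient.smul_mk, smul_eq_mul, mul_one]
      exact Quotient.out_eq _
    rw [K1.basisMap_apply, map_sum, Finsupp.finsetSum_apply, Finset.sum_eq_single (e x)]
    · rw [LambdaInf.act_ofGroup, hι, tensorQuotient_tmul_single, h2,
        tensorQuotientFinsupp_tmul_single, Equiv.symm_apply_apply, Finsupp.single_eq_same]
    · intro i _ hi
      rw [LambdaInf.act_ofGroup, hι, tensorQuotient_tmul_single, h2,
        tensorQuotientFinsupp_tmul_single, Finsupp.single_eq_of_ne]
      rintro rfl
      exact hi (e.apply_symm_apply i).symm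
    · simp
  have hinv : ∀ (g : G) v, ρ g⁻¹ (ρ g v) = v := fun g v => by
    rw [← Module.End.mul_apply, ← map_mul, inv_mul_cancel, map_one, Module.End.one_apply]
  constructor
  · intro w w' h
    funext i
    have h2 := h1 w (e.symm i)
    rw [show K1.basisMap _ ι (fun i => LambdaInf.ofGroup p (r i)) w = _ from h, h1,
      Equiv.apply_symm_apply] at h2
    rw [← hinv (r i) (w i), ← h2, hinv]
  · intro u
    refine ⟨fun i => ρ (r i)⁻¹ (tensorQuotientFinsupp p H V u (e.symm i)), ?_⟩
    rw [← (tensorQuotientFinsupp p H V).injective.eq_iff]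
    ext x
    refine (h1 _ x).trans ?_
    have h3 := hinv (r (e x))⁻¹ (tensorQuotientFinsupp p H V u x)
    rw [inv_inv] at h3
    change ρ (r (e x)) (ρ (r (e x))⁻¹ (tensorQuotientFinsupp p H V u (e.symm (e x)))) = _
    rwa [e.symm_apply_apply x]

variable [CompactSpace G]

/-- The homomorphism `Det` sends the class of a representation, reducible or not, to the
determinant on this representation. -/
theorem detRep_repClass [FiniteDimensional (PadicAlgCl p) V]
    {ρ : Representation (PadicAlgCl p) G V} (hρ : IsSmoothRep ρ) (n : ℕ)
    (g : K1Theory.GLn n (LambdaInf p G)) :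
    (detRep (K1.of _ n g) (.ofAdd (repClass ρ)) : PadicAlgCl p) =
      LinearMap.det (K1.blockEnd (LambdaInf.act ρ hρ) n g.1) := by
  obtain ⟨τ, ⟨e⟩⟩ := exists_equiv_fin ρ
  have hτ := hρ.of_equiv e
  rw [repClass_congr e, det_blockEnd_act_congr e hρ hτ]
  refine IsSmoothRep.induction (motive := fun τ => ∀ hτ : IsSmoothRep τ,
    (detRep (K1.of _ n g) (.ofAdd (repClass τ)) : PadicAlgCl p) =
      LinearMap.det (K1.blockEnd (LambdaInf.act τ hτ) n g.1)) (fun τ hτ => ?_) ?_ hτ hτ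
  · rw [repClass_of_subsingleton, ofAdd_zero, map_one, Units.val_one,
      LinearMap.det_eq_one_of_subsingleton]
  · intro d e π σ hσ ih ρ f hρ
    rw [repClass_congr f, repClass_prod π.smooth hσ, ofAdd_add, map_mul, Units.val_mul, ih hσ,
      repClass_irreducible, detRep_irreducible,
      det_blockEnd_act_congr f hρ (π.smooth.prod hσ)]
    exact (K1.det_blockEnd_prod (LinearEquiv.refl _ _)
      (LambdaInf.act_prod π.smooth hσ (π.smooth.prod hσ)) n g.1).symm

/-- The norm operator is adjoint to the operator `ι` under the Hom-description: the determinant of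
a transfer on `V` is the determinant on `Λ^∞(G) ⊗ V = V ⊗ ℚ_p[G/H]`. -/
theorem homDescription_normOp {H : Subgroup G} (hH : IsOpen (H : Set G))
    (x : K1 (LambdaInf p G)) :
    homDescription p G (normOp p H hH x) = iotaAdjoint p H (homDescription p G x) := by
  refine Subtype.ext (repRing_hom_ext fun π => ?_)
  obtain ⟨n, g, rfl⟩ := K1.exists_of x
  change detRep _ _ = detRep (K1.of _ n g) (.ofAdd (iota p H (FreeAbelianGroup.of π)))
  have : Finite (G ⧸ H) := Subgroup.quotient_finite_of_isOpen _ hH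
  let ρ := π.out.ρ
  have hρ : IsSmoothRep ρ := π.out.smooth
  have hτ : IsSmoothRep (tensorQuotient H ρ) := hρ.tensorQuotient hH
  let e := Finite.equivFin (G ⧸ H)
  -- the basis by which the transfer is defined; it need not consist of coset representatives
  let b := (LambdaInf.rightFree_can p hH).choose_spec.choose_spec
  have hr : ∀ g, ∃! i, ((e.symm i).out)⁻¹ * g ∈ H := by
    intro g
    refine ⟨e g, ?_, fun i hi => ?_⟩
    · change (e.symm (e g)).out⁻¹ * g ∈ H
      rw [Equiv.symm_apply_apply, ← QuotientGroup.eq]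
      exact Quotient.out_eq _
    · have hi' : (e.symm i).out⁻¹ * g ∈ H := hi
      rw [← QuotientGroup.eq] at hi'
      rw [← hi']
      simp
  let ι : (Fin π.out.dim → PadicAlgCl p) →ₗ[PadicAlgCl p]
      (Fin π.out.dim → PadicAlgCl p) ⊗[ℚ_[p]] MonoidAlgebra ℚ_[p] (G ⧸ H) :=
    (tensorQuotientFinsupp p H _).symm.toLinearMap ∘ₗ Finsupp.lsingle ((1 : G) : G ⧸ H)
  have hι : ∀ v, ι v = v ⊗ₜ MonoidAlgebra.single ((1 : G) : G ⧸ H) 1 := fun v => by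
    change (tensorQuotientFinsupp p H _).symm (Finsupp.single _ v) = _
    rw [← tensorQuotientFinsupp_tmul_single (p := p) H v, LinearEquiv.symm_apply_apply]
  have hιH : ∀ h ∈ H, ∀ v, ι (ρ h v) = tensorQuotient H ρ h (ι v) := by
    intro h hh v
    rw [hι, hι, tensorQuotient_tmul_single]
    congr 2
    rw [MulAction.Quotient.smul_mk, smul_eq_mul, mul_one, QuotientGroup.eq]
    simpa using hh
  ext
  rw [iota, FreeAbelianGroup.lift_apply_of, detRep_repClass hτ, detRep_of, LambdaInf.det]
  -- on representatives of `K₁`, the norm of `g` is the image in `Λ^∞(G)` of its block matrix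
  change ((K1.detHom _ (K1.of _ (n * _) _) : (PadicAlgCl p)ˣ) : PadicAlgCl p) = _
  rw [K1.detHom_of_eq_det]
  exact b.det_blockEnd_transfer (φ := (LambdaInf.act ρ hρ).comp (LambdaInf.can p H))
    (LambdaInf.isRightBasis_ofGroup hH hr)
    (fun c v => LambdaInf.map_act_can hρ hτ ι hιH c v)
    (bijective_basisMap_ofGroup ρ hτ e ι hι) n g.1

end HomDescriptionNorm

theorem mainTheorem6 (p : ℕ) [Fact p.Prime] (hp : p ≠ 2) (n : ℕ) (G : Type*) [Group G]
    [TopologicalSpace G] [IsTopologicalGroup G] [CompactSpace G] [T2Space G]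
    [TotallyDisconnectedSpace G] [ChartedSpace (Fin n → ℚ_[p]) G]
    [LieGroup 𝓘(ℚ_[p], Fin n → ℚ_[p]) ω G]
    (hpro : ∀ U : OpenNormalSubgroup G, IsPGroup p (G ⧸ U.toSubgroup))
    (P : Subgroup G) (hP : (P : Set G) = Set.range fun g : G => g ^ p) :
    iota p P = (indRep p P).comp (resRep p P) ∧
      ∀ x : K1 (LambdaInf p G),
        homDescription p G (normOp p P (isOpen_of_coe_eq_range_pow p n hP) x) =
          iotaAdjoint p P (homDescription p G x) := by
  have hopen : IsOpen (P : Set G) := isOpen_of_coe_eq_range_pow p n hP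
  exact ⟨iota_eq_indRep_comp_resRep hopen, homDescription_normOp hopen⟩
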